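/- For real numbers $B,C>0$, $0\le\delta<1$ and an integer $n\ge 1$, let $\mathcal M_{n,\delta}(B,C)$ be the (finite, non-empty) set of square matrices $(a_{ij})$ with entries in $\mathbb N=\{0,1,2,\dots\}$, of size $\lfloor n^\delta\rfloor+n$, whose first $\lfloor n^\delta\rfloor$ rows and first $\lfloor n^\delta\rfloor$ columns all have sum $\lfloor BCn\rfloor$ and whose last $n$ rows and last $n$ columns all have sum $\lfloor Cn\rfloor$. Put $B_c=1+\sqrt{1+1/C}$. On some probability space let $X^{(n)}=(X^{(n)}_{ij})$, $n\ge1$, be random matrices such that, for every $n$, $X^{(n)}$ is uniformly distributed on $\mathcal M_{n,\delta}(B,C)$; the joint law of the matrices for different $n$ is arbitrary. (i) If $1/2<\delta<1$ and $B\neq B_c$, then almost surely $$\lim_{n\to\infty}\frac1n\sum_{k=1}^n X^{(n)}_{1,\,k+\lfloor n^\delta\rfloor}=\begin{cases} BC & \text{if } B<B_c,\\ B_cC & \text{if } B>B_c.\end{cases}$$ (ii) For all $B,C>0$ and $0\le\delta<1$, almost surely $$\lim_{n\to\infty}\frac1n\sum_{k=1}^n X^{(n)}_{n+1,\,k+\lfloor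 n^\delta\rfloor}=C.$$ -/

import Mathlib

open MeasureTheory ProbabilityTheory Filter Topology

/-- `p × q` matrices with entries in `ℕ`, with the product measurable structure,
for which every set is measurable. -/
abbrev Table (p q : ℕ) : Type := Fin p → Fin q → ℕ

/-- The set of contingency tables (matrices with entries in `ℕ`) with row sums `r`
and column sums `c`. -/
def contingencyTables {p q : ℕ} (r : Fin p → ℕ) (c : Fin q → ℕ) :
    Set (Table p q) :=
  {A | (∀ i, ∑ j, A i j = r i) ∧ (∀ j, ∑ i, A i j = c j)}

/-- The number `⌊n ^ δ⌋` of special rows (and columns). -/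
noncomputable def bezel (n : ℕ) (δ : ℝ) : ℕ := ⌊(n : ℝ) ^ δ⌋₊

/-- The margin vector of length `⌊n ^ δ⌋ + n`, whose first `⌊n ^ δ⌋` entries are `⌊B * C * n⌋`
and whose last `n` entries are `⌊C * n⌋`. -/
noncomputable def blockMargin (n : ℕ) (δ B C : ℝ) : Fin (bezel n δ + n) → ℕ :=
  fun i => if (i : ℕ) < bezel n δ then ⌊B * C * n⌋₊ else ⌊C * n⌋₊

/-- The set of square contingency tables whose row margins and column margins
are both `blockMargin n δ B C`. -/
noncomputable def blockTables (n : ℕ) (δ B C : ℝ) :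
    Set (Table (bezel n δ + n) (bezel n δ + n)) :=
  contingencyTables (blockMargin n δ B C) (blockMargin n δ B C)

/-- The entry in row `i` and column `j` of a table, where rows and columns are numbered from `1`
(and `0` if there is no such row or no such column). -/
def entry {p q : ℕ} (A : Table p q) (i j : ℕ) : ℕ :=
  if h : (1 ≤ i ∧ i ≤ p) ∧ (1 ≤ j ∧ j ≤ q) then
    A ⟨i - 1, by omega⟩ ⟨j - 1, by omega⟩
  else 0

/-- The critical value `1 + √(1 + 1 / C)`. -/
noncomputable def criticalValue (C : ℝ) : ℝ := 1 + Real.sqrt (1 + 1 / C)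

/-! Write m = ⌊n^δ⌋; the first m rows and columns are called special, the others normal. The main
tool is resampling: given all other rows and the sum d of two rows of a uniform table, the first of
the two is uniform among the vectors 0 ≤ x ≤ d with the required coordinate sum. The number of such
vectors is symmetric and unimodal as a function of that sum (`boxCount_centerUnimodal`), being a
convolution of uniform weights on intervals. This has three consequences.

Moments. Two rows with equal margins share each d j without concentrating near the ends, so every
moment of an entry is controlled by the previous moment and the column margin
(`sum_sum_tables_pow_succ_le`). Hence large entries are improbable. In particular a normal row has
entries below εn/m in the special columns, at most εn in total, which gives (ii).

Deviations. Dropping the constraint on the coordinate sum costs a polynomial factor, and a Hoeffding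
bound then shows that the special rows have nearly equal sums over the special columns
(`card_tables_row_deviation_le`). So row 1 has about T/m there, where T is the sum of the
special-by-special block.

Counting. Moving two margins towards each other does not decrease the number of tables with a given
block sum (`tableCount_le_of_margins`). So among the matrices with prescribed sums of the four
blocks, those with the required margins make up a fraction at least exp(-O(n log n)). Up to this
factor, the number of tables with T = t is a product of four stars-and-bars counts
(`card_blockFiber`). If the mixed blocks have sum βmn and t has order mn, the ratio of consecutive
products is close to (β/(1+β))²(1+1/C), which crosses 1 exactly at β = B_c C. For δ > 0 a number of
steps of order mn outweighs n log n, so T/(mn) concentrates at max(0, BC - B_c C). Subtracting T/m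
from the margin BCn gives (i).

All exceptional proportions are O(n⁻²), so the first Borel–Cantelli lemma applies under any joint
law. -/

namespace ContingencyTable

/-! ### Vectors in a box with prescribed coordinate sum: symmetry and unimodality. -/

section Box

variable {κ : Type*} [Fintype κ] [DecidableEq κ]

/-- The vectors of natural numbers that are at most `d` in every coordinate. -/
def box (d : κ → ℕ) : Finset (κ → ℕ) := Fintype.piFinset fun j => Finset.range (d j + 1)

theorem mem_box {d x : κ → ℕ} : x ∈ box d ↔ ∀ j, x j ≤ d j := by
  simp [box]

/-- The number of vectors in `box d` with coordinate sum `z`. -/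
def boxCount (d : κ → ℕ) (z : ℤ) : ℕ := {x ∈ box d | ∑ j, (x j : ℤ) = z}.card

theorem sum_update_intCast (x : κ → ℕ) (j : κ) (a : ℕ) :
    ∑ k, (Function.update x j a k : ℤ) = ∑ k, (x k : ℤ) - x j + a := by
  rw [← Finset.add_sum_erase _ _ (Finset.mem_univ j),
    ← Finset.add_sum_erase Finset.univ (fun k => (x k : ℤ)) (Finset.mem_univ j)]
  rw [Finset.sum_congr rfl (g := fun k => (x k : ℤ))]
  · simp; ring
  · intro k hk
    rw [Function.update_of_ne (Finset.ne_of_mem_erase hk)]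

/-- Replacing `d j` by 0 removes coordinate `j` without changing the index type, which keeps the
induction over coordinates simple. -/
theorem card_box_filter_coord (d : κ → ℕ) (j : κ) (z : ℤ) {a : ℕ} (ha : a ≤ d j) :
    {x ∈ {x ∈ box d | ∑ k, (x k : ℤ) = z} | x j = a}.card
      = boxCount (Function.update d j 0) (z - a) := by
  refine Finset.card_nbij' (fun x => Function.update x j 0) (fun x => Function.update x j a)
    ?_ ?_ ?_ ?_
  · intro x hx
    simp only [Finset.coe_filter, Finset.mem_filter, Set.mem_ofPred_eq, mem_box] at hx ⊢
    refine ⟨fun k => ?_, ?_⟩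
    · by_cases hk : k = j
      · subst hk; simp
      · simp [hk, hx.1.1 k]
    · rw [sum_update_intCast, hx.1.2, hx.2]; simp
  · intro x hx
    simp only [Finset.coe_filter, Finset.mem_filter, Set.mem_ofPred_eq, mem_box] at hx ⊢
    have h0 : x j = 0 := by simpa using hx.1 j
    refine ⟨⟨fun k => ?_, ?_⟩, by simp⟩
    · by_cases hk : k = j
      · subst hk; simpa using ha
      · simpa [hk] using hx.1 k
    · rw [sum_update_intCast, hx.2, h0]; simp
  · intro x hx
    simp only [Finset.coe_filter, Finset.mem_filter, Set.mem_ofPred_eq] at hx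
    simp [← hx.2]
  · intro x hx
    simp only [Finset.coe_filter, Set.mem_ofPred_eq, mem_box] at hx
    have h0 : x j = 0 := by simpa using hx.1 j
    simp [← h0]

theorem sum_box_coord (d : κ → ℕ) (j : κ) (z : ℤ) (h : ℕ → ℝ) :
    ∑ x ∈ box d with ∑ k, (x k : ℤ) = z, h (x j)
      = ∑ a ∈ Finset.range (d j + 1), h a * boxCount (Function.update d j 0) (z - a) := by
  rw [← Finset.sum_fiberwise_of_maps_to (g := fun x => x j) (t := Finset.range (d j + 1))]
  · refine Finset.sum_congr rfl fun a ha => ?_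
    rw [← card_box_filter_coord d j z (Nat.lt_succ_iff.mp (Finset.mem_range.mp ha)),
      Finset.sum_congr rfl (g := fun _ => h a)]
    · simp [mul_comm]
    · intro x hx
      rw [(Finset.mem_filter.mp hx).2]
  · intro x hx
    simpa [Nat.lt_succ_iff] using mem_box.mp (Finset.mem_filter.mp hx).1 j

theorem boxCount_eq_sum (d : κ → ℕ) (j : κ) (z : ℤ) :
    boxCount d z
      = ∑ a ∈ Finset.range (d j + 1), boxCount (Function.update d j 0) (z - a) := by
  have := sum_box_coord d j z fun _ => 1
  simp only [Finset.sum_const, nsmul_eq_mul, mul_one, one_mul] at this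
  unfold boxCount at this ⊢
  apply Nat.cast_injective (R := ℝ)
  rw [this]
  push_cast
  rfl

/-- `f` is symmetric about `c / 2` and decreases away from it. -/
def CenterUnimodal (f : ℤ → ℕ) (c : ℤ) : Prop :=
  ∀ a b : ℤ, |2 * a - c| ≤ |2 * b - c| → f b ≤ f a

theorem CenterUnimodal.reflect {f : ℤ → ℕ} {c : ℤ} (hf : CenterUnimodal f c) (z : ℤ) :
    f (c - z) = f z := by
  apply le_antisymm <;> apply hf <;> rw [show 2 * (c - z) - c = -(2 * z - c) by ring, abs_neg]

theorem centerUnimodal_of_step {f : ℤ → ℕ} {c : ℤ} (hs : ∀ z, f (c - z) = f z)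
    (hm : ∀ z, 2 * z + 1 ≤ c → f z ≤ f (z + 1)) : CenterUnimodal f c := by
  have key : ∀ b a : ℤ, b ≤ a → 2 * a ≤ c → f b ≤ f a := by
    intro b a hba
    induction a, hba using Int.leInduction with
    | base => intro _; exact le_rfl
    | succ k hk ih =>
      intro h
      exact (ih (by omega)).trans (hm k (by omega))
  have red : ∀ z : ℤ, ∃ y, f y = f z ∧ 2 * y - c = - |2 * z - c| := by
    intro z
    rcases le_total (2 * z) c with h | h
    · exact ⟨z, rfl, by rw [abs_of_nonpos (by omega)]; ring⟩
    · exact ⟨c - z, hs z, by rw [abs_of_nonneg (by omega)]; ring⟩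
  intro a b hab
  obtain ⟨a', ha, ha'⟩ := red a
  obtain ⟨b', hb, hb'⟩ := red b
  rw [← ha, ← hb]
  have := abs_nonneg (2 * a - c)
  exact key _ _ (by omega) (by omega)

/-- From z to z + 1 the window sum gains f (z + 1) and loses f (z - d). Below the new centre, z + 1
is at least as close to c / 2 as z - d. -/
theorem CenterUnimodal.window {f : ℤ → ℕ} {c : ℤ} (hf : CenterUnimodal f c) (d : ℕ) :
    CenterUnimodal (fun z => ∑ a ∈ Finset.range (d + 1), f (z - a)) (c + d) := by
  apply centerUnimodal_of_step
  · intro z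
    rw [← Finset.sum_range_reflect]
    refine Finset.sum_congr rfl fun a ha => ?_
    rw [← hf.reflect]
    congr 1
    have := Finset.mem_range.mp ha
    have : ((d + 1 - 1 - a : ℕ) : ℤ) = d - a := by omega
    rw [this]; ring
  · intro z hz
    rw [Finset.sum_range_succ, Finset.sum_range_succ']
    have h1 : f (z - d) ≤ f (z + 1 - (0 : ℕ)) := by
      apply hf
      rw [abs_le]
      constructor
      · have := neg_abs_le (2 * (z - d) - c)
        have : 2 * (z - d) - c ≤ 0 := by omega
        rw [abs_of_nonpos this]
        push_cast
        omega
      · have : 2 * (z - d) - c ≤ 0 := by omega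
        rw [abs_of_nonpos this]
        push_cast
        omega
    refine add_le_add (le_of_eq (Finset.sum_congr rfl fun a _ => ?_)) h1
    congr 1
    push_cast
    ring

theorem sum_update_zero_add (d : κ → ℕ) (j : κ) :
    ∑ k, Function.update d j 0 k + d j = ∑ k, d k := by
  rw [← Finset.sum_erase_add _ _ (Finset.mem_univ j),
    ← Finset.sum_erase_add Finset.univ d (Finset.mem_univ j),
    Finset.sum_congr rfl (g := d)]
  · simp
  · intro k hk
    rw [Function.update_of_ne (Finset.ne_of_mem_erase hk)]

/-- Induction on the number of nonzero coordinates of `d`: restoring one coordinate is a window sum.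
-/
theorem boxCount_centerUnimodal (d : κ → ℕ) :
    CenterUnimodal (boxCount d) ((∑ j, d j : ℕ) : ℤ) := by
  induction hN : {j | d j ≠ 0}.toFinset.card using Nat.strong_induction_on generalizing d with
  | _ N ih =>
    by_cases h : ∃ j, d j ≠ 0
    · obtain ⟨j, hj⟩ := h
      have h1 := (ih _ ?_ (Function.update d j 0) rfl).window (d j)
      · have h2 : (fun z => ∑ a ∈ Finset.range (d j + 1),
            boxCount (Function.update d j 0) (z - a)) = boxCount d := by
          funext z; rw [boxCount_eq_sum d j z]
        rw [h2] at h1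
        rw [← sum_update_zero_add d j]
        exact_mod_cast h1
      · rw [← hN]
        apply Finset.card_lt_card
        rw [Finset.ssubset_iff_of_subset]
        · exact ⟨j, by simpa using hj, by simp⟩
        · intro k
          by_cases hk : k = j
          · subst hk; simp
          · simp [hk]
    · push Not at h
      have hd : d = 0 := funext h
      subst hd
      intro a b hab
      have hbox : box (0 : κ → ℕ) = {0} := by
        ext x
        simp [mem_box, funext_iff]
      simp only [boxCount, hbox, Finset.filter_singleton]
      simp only [Pi.zero_apply, Finset.sum_const_zero, Nat.cast_zero, sub_zero] at hab ⊢
      by_cases hb : (0 : ℤ) = b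
      · subst hb
        have : a = 0 := by simp at hab; grind
        simp [this]
      · simp [hb]

/-- Pigeonhole: there are 2R + 1 possible coordinate sums, and the central one is the most frequent.
-/
theorem card_box_le (d : κ → ℕ) {R : ℕ} (hR : ∑ j, d j = 2 * R) :
    (box d).card ≤ (2 * R + 1) * boxCount d R := by
  rw [Finset.card_eq_sum_card_fiberwise (f := fun x => ∑ j, x j) (t := Finset.range (2 * R + 1))]
  · calc _ ≤ ∑ s ∈ Finset.range (2 * R + 1), boxCount d R := by
          refine Finset.sum_le_sum fun s _ => ?_
          have h1 : boxCount d s ≤ boxCount d R := by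
            apply boxCount_centerUnimodal d
            rw [hR]
            simp
          refine le_trans (le_of_eq ?_) h1
          rw [boxCount]
          congr 1
          ext x
          simp only [Finset.mem_filter]
          norm_cast
      _ = _ := by simp
  · intro x hx
    have := Finset.sum_le_sum fun j (_ : j ∈ Finset.univ) => mem_box.mp hx j
    simp only [Finset.coe_range, Set.mem_Iio]
    omega

end Box

/-! ### Moment inequalities for symmetric unimodal weights. -/

theorem sum_range_mul_sub (n : ℕ) :
    6 * ∑ a ∈ Finset.range (n + 1), (a : ℝ) * (n - a) = n * (n - 1) * (n + 1) := by
  have key : ∀ (k : ℕ) (y : ℝ), 6 * ∑ a ∈ Finset.range (k + 1), (a : ℝ) * (y - a)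
      = k * (k + 1) * (3 * y - (2 * k + 1)) := by
    intro k y
    induction k with
    | zero => simp
    | succ k ih =>
      rw [Finset.sum_range_succ, mul_add, ih]
      push_cast
      ring
  rw [key]
  ring

section Weight

variable {n : ℕ} {w : ℕ → ℝ}

theorem sum_mul_weight_reflect
    (hw : ∀ a b : ℕ, |2 * (a : ℤ) - n| ≤ |2 * (b : ℤ) - n| → w b ≤ w a) (f : ℕ → ℝ) :
    ∑ a ∈ Finset.range (n + 1), f (n - a) * w a = ∑ a ∈ Finset.range (n + 1), f a * w a := by
  rw [← Finset.sum_range_reflect]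
  refine Finset.sum_congr rfl fun a ha => ?_
  have ha' : a ≤ n := Nat.lt_succ_iff.mp (Finset.mem_range.mp ha)
  have h1 : n + 1 - 1 - a = n - a := by omega
  have h2 : |2 * ((n - a : ℕ) : ℤ) - n| = |2 * (a : ℤ) - n| := by
    rw [Nat.cast_sub ha', show 2 * ((n : ℤ) - a) - n = -(2 * a - n) by ring, abs_neg]
  have h3 : w (n - a) = w a := le_antisymm (hw _ _ h2.ge) (hw _ _ h2.le)
  rw [h1, h3, Nat.sub_sub_self ha']

/-- Chebyshev's sum inequality: a(n - a) and w both decrease away from n/2, so the w-average of a(n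
- a) is at least its plain average n(n - 1)/6. -/
theorem sq_mul_sum_weight_le
    (hw : ∀ a b : ℕ, |2 * (a : ℤ) - n| ≤ |2 * (b : ℤ) - n| → w b ≤ w a) :
    (n : ℝ) ^ 2 * ∑ a ∈ Finset.range (n + 1), w a
      ≤ 6 * ∑ a ∈ Finset.range (n + 1), (a : ℝ) * (n - a) * w a
        + n * ∑ a ∈ Finset.range (n + 1), w a := by
  have hmono : MonovaryOn (fun a : ℕ => (a : ℝ) * (n - a)) w (Finset.range (n + 1)) := by
    intro a _ b _ hab
    by_contra hlt
    push Not at hlt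
    refine absurd (hw a b ?_) (not_le.mpr hab)
    have h1 : ((b : ℤ) * (n - b) : ℤ) < a * (n - a) := by exact_mod_cast hlt
    -- The comparison rests on (2a - n)² = n² - 4a(n - a).
    apply abs_le_of_sq_le_sq' _ (abs_nonneg _) |> abs_le.mpr
    rw [sq_abs]
    nlinarith
  have h := hmono.sum_mul_sum_le_card_mul_sum
  rw [Finset.card_range] at h
  have h6 := sum_range_mul_sub n
  have hn : (0 : ℝ) < n + 1 := by positivity
  have h7 : ((n : ℝ) + 1) * ((n : ℝ) * (n - 1) * ∑ a ∈ Finset.range (n + 1), w a)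
      ≤ ((n : ℝ) + 1) * (6 * ∑ a ∈ Finset.range (n + 1), (a : ℝ) * (n - a) * w a) := by
    push_cast at h
    calc _ = (n : ℝ) * (n - 1) * (n + 1) * ∑ a ∈ Finset.range (n + 1), w a := by ring
      _ = 6 * ((∑ a ∈ Finset.range (n + 1), (a : ℝ) * (n - a))
          * ∑ a ∈ Finset.range (n + 1), w a) := by rw [← h6]; ring
      _ ≤ _ := by linarith
  have h8 := le_of_mul_le_mul_left h7 hn
  linarith

/-- Multiply the quadratic bound by a power of n, use n^p ≤ 2^p (a^p + (n - a)^p), and fold the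
second term onto the first by reflection; this doubles 6 to 12. The exponent 0 needs reflection
only. -/
theorem pow_succ_mul_sum_weight_le (hw0 : ∀ a, 0 ≤ w a)
    (hw : ∀ a b : ℕ, |2 * (a : ℤ) - n| ≤ |2 * (b : ℤ) - n| → w b ≤ w a) (p : ℕ) :
    (n : ℝ) ^ (p + 1) * ∑ a ∈ Finset.range (n + 1), w a
      ≤ 12 * 2 ^ p * ∑ a ∈ Finset.range (n + 1), (a : ℝ) ^ p * (n - a : ℕ) * w a
        + n ^ p * ∑ a ∈ Finset.range (n + 1), w a := by
  have hW : 0 ≤ ∑ a ∈ Finset.range (n + 1), w a := Finset.sum_nonneg fun a _ => hw0 a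
  rcases p with _ | p
  · have h := sum_mul_weight_reflect hw fun a => (a : ℝ)
    have h2 : (n : ℝ) * ∑ a ∈ Finset.range (n + 1), w a
        = ∑ a ∈ Finset.range (n + 1), ((n - a : ℕ) : ℝ) * w a
          + ∑ a ∈ Finset.range (n + 1), (a : ℝ) * w a := by
      rw [Finset.mul_sum, ← Finset.sum_add_distrib]
      refine Finset.sum_congr rfl fun a ha => ?_
      rw [Nat.cast_sub (Nat.lt_succ_iff.mp (Finset.mem_range.mp ha))]
      ring
    have h3 : 0 ≤ ∑ a ∈ Finset.range (n + 1), ((n - a : ℕ) : ℝ) * w a :=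
      Finset.sum_nonneg fun a _ => mul_nonneg (Nat.cast_nonneg _) (hw0 a)
    simp only [zero_add, pow_one, pow_zero, mul_one, one_mul]
    rw [h2]
    linarith
  · have h := sum_mul_weight_reflect hw fun a => (a : ℝ) ^ (p + 1) * (n - a : ℕ)
    have h1 : (n : ℝ) ^ p * ∑ a ∈ Finset.range (n + 1), (a : ℝ) * (n - a) * w a
        ≤ 2 ^ p * (∑ a ∈ Finset.range (n + 1), (a : ℝ) ^ (p + 1) * (n - a : ℕ) * w a
          + ∑ a ∈ Finset.range (n + 1),
            ((n - a : ℕ) : ℝ) ^ (p + 1) * (n - (n - a) : ℕ) * w a) := by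
      rw [← Finset.sum_add_distrib, Finset.mul_sum, Finset.mul_sum]
      refine Finset.sum_le_sum fun a ha => ?_
      have ha' : a ≤ n := Nat.lt_succ_iff.mp (Finset.mem_range.mp ha)
      rw [Nat.sub_sub_self ha']
      obtain ⟨b, rfl⟩ := Nat.exists_eq_add_of_le ha'
      have h2 : ((a + b : ℕ) : ℝ) ^ p ≤ 2 ^ p * ((a : ℝ) ^ p + (b : ℝ) ^ p) := by
        have ha0 : (0 : ℝ) ≤ a := Nat.cast_nonneg a
        have hb0 : (0 : ℝ) ≤ b := Nat.cast_nonneg b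
        push_cast
        rcases le_total (a : ℝ) b with hab | hab
        · calc ((a : ℝ) + b) ^ p ≤ (2 * b) ^ p := by gcongr; linarith
            _ = 2 ^ p * (b : ℝ) ^ p := by rw [mul_pow]
            _ ≤ _ := by gcongr; linarith [pow_nonneg ha0 p]
        · calc ((a : ℝ) + b) ^ p ≤ (2 * a) ^ p := by gcongr; linarith
            _ = 2 ^ p * (a : ℝ) ^ p := by rw [mul_pow]
            _ ≤ _ := by gcongr; linarith [pow_nonneg hb0 p]
      have h3 : (0 : ℝ) ≤ a * b * w a := by have := hw0 a; positivity
      have h4 := mul_le_mul_of_nonneg_right h2 h3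
      rw [Nat.add_sub_cancel_left]
      push_cast at h4 ⊢
      calc _ = ((a : ℝ) + b) ^ p * (a * b * w a) := by ring
        _ ≤ _ := h4
        _ = _ := by ring
    have h2 := mul_le_mul_of_nonneg_left (sq_mul_sum_weight_le hw)
      (pow_nonneg (Nat.cast_nonneg n) p : (0 : ℝ) ≤ (n : ℝ) ^ p)
    rw [h] at h1
    calc _ = (n : ℝ) ^ p * ((n : ℝ) ^ 2 * ∑ a ∈ Finset.range (n + 1), w a) := by ring
      _ ≤ _ := h2
      _ = 6 * ((n : ℝ) ^ p * ∑ a ∈ Finset.range (n + 1), (a : ℝ) * (n - a) * w a)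
          + n ^ (p + 1) * ∑ a ∈ Finset.range (n + 1), w a := by ring
      _ ≤ _ := by
        have : 0 ≤ (2 : ℝ) ^ p * ∑ a ∈ Finset.range (n + 1),
            (a : ℝ) ^ (p + 1) * (n - a : ℕ) * w a :=
          mul_nonneg (by positivity) (Finset.sum_nonneg fun a _ => by
            have := hw0 a
            positivity)
        rw [pow_succ (2 : ℝ) p]
        linarith

end Weight

/-! ### Moments and Hoeffding bounds in a box. -/

section Box

variable {κ : Type*} [Fintype κ] [DecidableEq κ]

/-- The value a of coordinate `j` has weight the count of the remaining box at R - a. This weight is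
centred at d j / 2 because `d` has total 2R. -/
theorem pow_succ_mul_boxCount_le (d : κ → ℕ) (j : κ) {R : ℕ} (hR : ∑ k, d k = 2 * R) (p : ℕ) :
    ∑ x ∈ box d with ∑ k, (x k : ℤ) = R, (d j : ℝ) ^ (p + 1)
      ≤ 12 * 2 ^ p * ∑ x ∈ box d with ∑ k, (x k : ℤ) = R, (x j : ℝ) ^ p * (d j - x j : ℕ)
        + ∑ x ∈ box d with ∑ k, (x k : ℤ) = R, (d j : ℝ) ^ p := by
  rw [sum_box_coord d j R fun _ => (d j : ℝ) ^ (p + 1), sum_box_coord d j R fun _ => (d j : ℝ) ^ p,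
    sum_box_coord d j R fun a => (a : ℝ) ^ p * (d j - a : ℕ), ← Finset.mul_sum, ← Finset.mul_sum]
  apply pow_succ_mul_sum_weight_le (fun a => Nat.cast_nonneg _)
  intro a b hab
  have h := boxCount_centerUnimodal (Function.update d j 0) (R - a) (R - b)
  have h2 := sum_update_zero_add d j
  have h3 : ∀ a : ℤ, 2 * ((R : ℤ) - a) - (∑ k, Function.update d j 0 k : ℕ)
      = -(2 * a - d j) := by
    intro a
    omega
  rw [h3, h3, abs_neg, abs_neg] at h
  exact_mod_cast h hab

/-- Reflection replaces exp by cosh, and cosh y ≤ exp(y²/2). -/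
theorem sum_exp_two_mul_sub_le (d : ℕ) (l : ℝ) :
    ∑ a ∈ Finset.range (d + 1), Real.exp (l * (2 * a - d))
      ≤ (d + 1) * Real.exp (l ^ 2 * d ^ 2 / 2) := by
  have h1 : ∑ a ∈ Finset.range (d + 1), Real.exp (l * (2 * a - d))
      = ∑ a ∈ Finset.range (d + 1), Real.exp (-(l * (2 * a - d))) := by
    rw [← Finset.sum_range_reflect]
    refine Finset.sum_congr rfl fun a ha => ?_
    have ha' : a ≤ d := Nat.lt_succ_iff.mp (Finset.mem_range.mp ha)
    rw [show d + 1 - 1 - a = d - a by omega, Nat.cast_sub ha']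
    congr 1
    ring
  have h2 : ∑ a ∈ Finset.range (d + 1), Real.exp (l * (2 * a - d))
      = ∑ a ∈ Finset.range (d + 1), Real.cosh (l * (2 * a - d)) := by
    simp_rw [Real.cosh_eq]
    rw [← Finset.sum_div, Finset.sum_add_distrib, ← h1]
    ring
  rw [h2]
  calc _ ≤ ∑ a ∈ Finset.range (d + 1), Real.exp (l ^ 2 * d ^ 2 / 2) := by
        refine Finset.sum_le_sum fun a ha => ?_
        have ha' : (a : ℝ) ≤ d := by exact_mod_cast Nat.lt_succ_iff.mp (Finset.mem_range.mp ha)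
        have ha0 : (0 : ℝ) ≤ a := Nat.cast_nonneg a
        refine (Real.cosh_le_exp_half_sq _).trans (Real.exp_le_exp.mpr ?_)
        rw [mul_pow]
        have : (2 * (a : ℝ) - d) ^ 2 ≤ d ^ 2 := by nlinarith
        gcongr
    _ = _ := by simp

theorem sum_box_exp_le (d : κ → ℕ) (J : Finset κ) (l : ℝ) :
    ∑ x ∈ box d, Real.exp (l * ∑ j ∈ J, (2 * (x j : ℝ) - d j))
      ≤ (box d).card * Real.exp (l ^ 2 * (∑ j ∈ J, (d j : ℝ) ^ 2) / 2) := by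
  have h1 : ∀ x : κ → ℕ, Real.exp (l * ∑ j ∈ J, (2 * (x j : ℝ) - d j))
      = ∏ j, (if j ∈ J then Real.exp (l * (2 * (x j : ℝ) - d j)) else 1) := by
    intro x
    rw [Finset.prod_ite_mem, Finset.univ_inter, Finset.mul_sum, Real.exp_sum]
  simp_rw [h1, box]
  rw [← Finset.prod_univ_sum (fun j => Finset.range (d j + 1))
    fun j a => if j ∈ J then Real.exp (l * (2 * (a : ℝ) - d j)) else 1]
  have h2 : Real.exp (l ^ 2 * (∑ j ∈ J, (d j : ℝ) ^ 2) / 2)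
      = ∏ j, (if j ∈ J then Real.exp (l ^ 2 * (d j : ℝ) ^ 2 / 2) else 1) := by
    rw [Finset.prod_ite_mem, Finset.univ_inter, Finset.mul_sum, Finset.sum_div, Real.exp_sum]
  rw [h2, Fintype.card_piFinset]
  push_cast
  rw [← Finset.prod_mul_distrib]
  refine Finset.prod_le_prod (fun j _ => Finset.sum_nonneg fun a _ => by split_ifs <;> positivity)
    fun j _ => ?_
  split_ifs with hj
  · simpa using sum_exp_two_mul_sub_le (d j) l
  · simp

/-- Chernoff's bound with parameter τ/V, for both signs; without a sum constraint the coordinates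
are independent. -/
theorem card_box_deviation_le (d : κ → ℕ) (J : Finset κ) {V τ : ℝ} (hV : 0 < V) (hτ : 0 ≤ τ)
    (hd : ∑ j ∈ J, (d j : ℝ) ^ 2 ≤ V) :
    ({x ∈ box d | τ ≤ |∑ j ∈ J, (2 * (x j : ℝ) - d j)|}.card : ℝ)
      ≤ 2 * Real.exp (-(τ ^ 2 / (2 * V))) * (box d).card := by
  have h1 : ∀ l : ℝ, ∑ x ∈ box d, Real.exp (l * ∑ j ∈ J, (2 * (x j : ℝ) - d j))
      ≤ (box d).card * Real.exp (l ^ 2 * V / 2) := fun l =>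
    (sum_box_exp_le d J l).trans (by gcongr)
  have h2 := h1 (τ / V)
  have h3 := h1 (-(τ / V))
  have h4 : ({x ∈ box d | τ ≤ |∑ j ∈ J, (2 * (x j : ℝ) - d j)|}.card : ℝ)
      * Real.exp (τ / V * τ)
      ≤ ∑ x ∈ box d, (Real.exp (τ / V * ∑ j ∈ J, (2 * (x j : ℝ) - d j))
        + Real.exp (-(τ / V) * ∑ j ∈ J, (2 * (x j : ℝ) - d j))) := by
    rw [← nsmul_eq_mul, ← Finset.sum_const]
    refine (Finset.sum_le_sum fun x hx => ?_).trans
      (Finset.sum_le_sum_of_subset_of_nonneg (Finset.filter_subset _ _)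
        fun x _ _ => by positivity)
    have hx := (Finset.mem_filter.mp hx).2
    rcases le_abs.mp hx with h | h
    · refine le_add_of_le_of_nonneg (Real.exp_le_exp.mpr ?_) (Real.exp_nonneg _)
      gcongr
    · refine le_add_of_nonneg_of_le (Real.exp_nonneg _) (Real.exp_le_exp.mpr ?_)
      rw [neg_mul, ← mul_neg]
      gcongr
  rw [Finset.sum_add_distrib] at h4
  rw [neg_sq] at h3
  have h5 : Real.exp ((τ / V) ^ 2 * V / 2)
      = Real.exp (-(τ ^ 2 / (2 * V))) * Real.exp (τ / V * τ) := by
    rw [← Real.exp_add]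
    congr 1
    field_simp
    ring
  rw [h5] at h2 h3
  refine le_of_mul_le_mul_right ?_ (Real.exp_pos (τ / V * τ))
  linarith

theorem card_box_deviation_le_boxCount (d : κ → ℕ) (J : Finset κ) {V τ : ℝ} (hV : 0 < V)
    (hτ : 0 ≤ τ) (hd : ∑ j ∈ J, (d j : ℝ) ^ 2 ≤ V) {R : ℕ} (hR : ∑ k, d k = 2 * R) :
    ({x ∈ box d | τ ≤ |∑ j ∈ J, (2 * (x j : ℝ) - d j)|}.card : ℝ)
      ≤ 2 * Real.exp (-(τ ^ 2 / (2 * V))) * (2 * R + 1) * boxCount d R := by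
  refine (card_box_deviation_le d J hV hτ hd).trans ?_
  rw [mul_assoc (2 * Real.exp _)]
  gcongr
  exact_mod_cast card_box_le d hR

end Box

/-! ### Resampling two rows of a table. -/

section Tables

variable {ι κ : Type*} [Fintype ι] [DecidableEq ι] [Fintype κ] [DecidableEq κ]

section Resample

/-- The class 𝒯 splits into fibres on which the other rows and the sum of the two rows are fixed.
Closedness makes each fibre a full box, so the inequality holds fibre by fibre. -/
theorem sum_le_sum_of_resample {ι κ : Type*} [DecidableEq ι] [Fintype κ] [DecidableEq κ]
    (𝒯 : Finset (ι → κ → ℕ)) {i i' : ι} (hne : i ≠ i')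
    (hcl : ∀ A ∈ 𝒯, ∀ B : ι → κ → ℕ, (∀ k, k ≠ i → k ≠ i' → B k = A k) →
      B i + B i' = A i + A i' → B ∈ 𝒯)
    (f g : (κ → ℕ) → (κ → ℕ) → ℝ)
    (hfg : ∀ A ∈ 𝒯, ∑ x ∈ box (A i + A i'), f x (A i + A i' - x)
      ≤ ∑ x ∈ box (A i + A i'), g x (A i + A i' - x)) :
    ∑ A ∈ 𝒯, f (A i) (A i') ≤ ∑ A ∈ 𝒯, g (A i) (A i') := by
  classical
  -- Row `i` is erased and row `i'` stores the sum, so the key records exactly the data that are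
  -- conditioned on.
  let key : (ι → κ → ℕ) → (ι → κ → ℕ) := fun A =>
    Function.update (Function.update A i 0) i' (A i + A i')
  have fiber : ∀ A ∈ 𝒯, ∀ h : (κ → ℕ) → (κ → ℕ) → ℝ,
      ∑ B ∈ 𝒯 with key B = key A, h (B i) (B i')
        = ∑ x ∈ box (A i + A i'), h x (A i + A i' - x) := by
    intro A hA h
    have hkey : ∀ B, key B = key A → (∀ k, k ≠ i → k ≠ i' → B k = A k) ∧
        B i + B i' = A i + A i' := by
      intro B hB
      refine ⟨fun k hk hk' => ?_, ?_⟩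
      · have := congrFun hB k
        simpa [key, hk, hk'] using this
      · have := congrFun hB i'
        simpa [key] using this
    refine Finset.sum_nbij' (fun B => B i)
      (fun x => Function.update (Function.update A i x) i' (A i + A i' - x)) ?_ ?_ ?_ ?_ ?_
    · intro B hB
      rw [mem_box, ← (hkey B (Finset.mem_filter.mp hB).2).2]
      intro j
      simp
    · intro x hx
      have hx' : x ≤ A i + A i' := mem_box.mp hx
      have hsum : x + (A i + A i' - x) = A i + A i' := by
        funext j
        have := hx' j
        simp only [Pi.add_apply, Pi.sub_apply] at this ⊢
        omega
      rw [Finset.mem_filter]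
      constructor
      · apply hcl A hA
        · intro k hk hk'
          simp [hk, hk']
        · simpa [hne] using hsum
      · funext k
        by_cases hk' : k = i'
        · subst hk'
          simpa [key, hne] using hsum
        · by_cases hk : k = i
          · subst hk
            simp [key, hk']
          · simp [key, hk, hk']
    · intro B hB
      obtain ⟨h1, h2⟩ := hkey B (Finset.mem_filter.mp hB).2
      funext k
      by_cases hk' : k = i'
      · subst hk'
        simp [← h2]
      · by_cases hk : k = i
        · subst hk
          simp [hk']
        · simp [hk, hk', h1]
    · intro x hx
      simp [hne]
    · intro B hB
      rw [← (hkey B (Finset.mem_filter.mp hB).2).2]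
      simp
  rw [← Finset.sum_fiberwise_of_maps_to (g := key) (t := 𝒯.image key)
      (fun A hA => Finset.mem_image_of_mem key hA),
    ← Finset.sum_fiberwise_of_maps_to (g := key) (t := 𝒯.image key)
      (fun A hA => Finset.mem_image_of_mem key hA)]
  refine Finset.sum_le_sum fun K hK => ?_
  obtain ⟨A, hA, rfl⟩ := Finset.mem_image.mp hK
  rw [fiber A hA f, fiber A hA g]
  exact hfg A hA

theorem sum_eq_of_pair_eq {ι : Type*} [DecidableEq ι] {M : Type*} [AddCommMonoid M] {S : Finset ι} {i i' : ι} (hne : i ≠ i')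
    (hS : i ∈ S ↔ i' ∈ S) {f g : ι → M} (h : ∀ k, k ≠ i → k ≠ i' → f k = g k)
    (hp : f i + f i' = g i + g i') : ∑ k ∈ S, f k = ∑ k ∈ S, g k := by
  by_cases hi : i ∈ S
  · have hi' := hS.mp hi
    have hi'' : i' ∈ S.erase i := Finset.mem_erase.mpr ⟨hne.symm, hi'⟩
    rw [← Finset.add_sum_erase _ _ hi, ← Finset.add_sum_erase _ g hi,
      ← Finset.add_sum_erase _ _ hi'', ← Finset.add_sum_erase _ g hi'', ← add_assoc, ← add_assoc, hp]
    congr 1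
    refine Finset.sum_congr rfl fun k hk => ?_
    simp only [Finset.mem_erase] at hk
    exact h k hk.2.1 hk.1
  · refine Finset.sum_congr rfl fun k hk => h k ?_ ?_
    · rintro rfl; exact hi hk
    · rintro rfl; exact hi (hS.mpr hk)

end Resample

/-- The finite set of tables with row sums `r` and column sums `c`. -/
def tables (r : ι → ℕ) (c : κ → ℕ) : Finset (ι → κ → ℕ) :=
  {A ∈ Fintype.piFinset fun _ : ι => box c |
    (∀ i, ∑ j, A i j = r i) ∧ ∀ j, ∑ i, A i j = c j}

theorem mem_tables {r : ι → ℕ} {c : κ → ℕ} {A : ι → κ → ℕ} :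
    A ∈ tables r c ↔ (∀ i, ∑ j, A i j = r i) ∧ ∀ j, ∑ i, A i j = c j := by
  simp only [tables, Finset.mem_filter, Fintype.mem_piFinset, and_iff_right_iff_imp, mem_box]
  intro h i j
  rw [← h.2 j]
  exact Finset.single_le_sum (f := fun i => A i j) (fun _ _ => Nat.zero_le _) (Finset.mem_univ i)

/-- The sum of the entries of `A` in the block `S × J`. -/
def blockSum (A : ι → κ → ℕ) (S : Finset ι) (J : Finset κ) : ℕ := ∑ i ∈ S, ∑ j ∈ J, A i j

/-- The tables with column sums `c`, row sums `r k` for `k ≠ i, i'`, and total sum `D` over the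
rows `i` and `i'`, with block sum `t` in `S × J`. -/
def pairTables (r : ι → ℕ) (c : κ → ℕ) (i i' : ι) (D : ℕ) (S : Finset ι) (J : Finset κ) (t : ℕ) :
    Finset (ι → κ → ℕ) :=
  {A ∈ Fintype.piFinset fun _ : ι => box c | ((∀ k, k ≠ i → k ≠ i' → ∑ j, A k j = r k) ∧
    ∑ j, (A i j + A i' j) = D ∧ ∀ j, ∑ i, A i j = c j) ∧ blockSum A S J = t}

theorem mem_pairTables {r : ι → ℕ} {c : κ → ℕ} {i i' : ι} {D : ℕ} {S : Finset ι} {J : Finset κ}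
    {t : ℕ} {A : ι → κ → ℕ} : A ∈ pairTables r c i i' D S J t ↔
      ((∀ k, k ≠ i → k ≠ i' → ∑ j, A k j = r k) ∧ ∑ j, (A i j + A i' j) = D ∧
        ∀ j, ∑ i, A i j = c j) ∧ blockSum A S J = t := by
  simp only [pairTables, Finset.mem_filter, Fintype.mem_piFinset, and_iff_right_iff_imp, mem_box]
  intro h i j
  rw [← h.1.2.2 j]
  exact Finset.single_le_sum (f := fun i => A i j) (fun _ _ => Nat.zero_le _) (Finset.mem_univ i)

/-- Both rows lie in `S` or both lie outside, so the block sum sees them only through `A i + A i'`.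
-/
theorem pairTables_closed {r : ι → ℕ} {c : κ → ℕ} {i i' : ι} (hne : i ≠ i') {D : ℕ}
    {S : Finset ι} (hS : i ∈ S ↔ i' ∈ S) {J : Finset κ} {t : ℕ} :
    ∀ A ∈ pairTables r c i i' D S J t, ∀ B : ι → κ → ℕ, (∀ k, k ≠ i → k ≠ i' → B k = A k) →
      B i + B i' = A i + A i' → B ∈ pairTables r c i i' D S J t := by
  intro A hA B h hp
  rw [mem_pairTables] at hA ⊢
  have hpj : ∀ j, B i j + B i' j = A i j + A i' j := fun j => congrFun hp j
  refine ⟨⟨fun k hk hk' => ?_, ?_, fun j => ?_⟩, ?_⟩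
  · rw [h k hk hk', hA.1.1 k hk hk']
  · simp_rw [hpj, hA.1.2.1]
  · rw [← hA.1.2.2 j]
    exact sum_eq_of_pair_eq hne (by simp) (fun k hk hk' => by rw [h k hk hk']) (hpj j)
  · rw [← hA.2]
    refine sum_eq_of_pair_eq hne hS (fun k hk hk' => by rw [h k hk hk']) ?_
    rw [← Finset.sum_add_distrib, ← Finset.sum_add_distrib]
    simp_rw [hpj]

theorem pairTables_filter (r : ι → ℕ) (c : κ → ℕ) {i i' : ι} (S : Finset ι)
    (J : Finset κ) (t : ℕ) :
    {A ∈ pairTables r c i i' (r i + r i') S J t | ∑ j, A i j = r i}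
      = {A ∈ tables r c | blockSum A S J = t} := by
  ext A
  simp only [Finset.mem_filter, mem_pairTables, mem_tables, Finset.sum_add_distrib]
  constructor
  · rintro ⟨⟨⟨h1, h2, h3⟩, h4⟩, h5⟩
    refine ⟨⟨fun k => ?_, h3⟩, h4⟩
    by_cases hk : k = i
    · rw [hk, h5]
    · by_cases hk' : k = i'
      · rw [hk']; omega
      · exact h1 k hk hk'
  · rintro ⟨⟨h1, h2⟩, h3⟩
    exact ⟨⟨⟨fun k _ _ => h1 k, by rw [h1, h1], h2⟩, h3⟩, h1 i⟩

/-- Averages over tables are dominated as soon as they are after resampling two rows. -/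
theorem sum_tables_le_sum_tables {r r' : ι → ℕ} {c : κ → ℕ} {i i' : ι} (hne : i ≠ i')
    (hr : ∀ k, k ≠ i → k ≠ i' → r k = r' k) (hrp : r i + r i' = r' i + r' i')
    {S : Finset ι} (hS : i ∈ S ↔ i' ∈ S) (J : Finset κ) (t : ℕ)
    (f g : (κ → ℕ) → (κ → ℕ) → ℝ)
    (hfg : ∀ d : κ → ℕ, ∑ j, d j = r i + r i' →
      ∑ x ∈ box d with ∑ j, (x j : ℤ) = r i, f x (d - x)
        ≤ ∑ x ∈ box d with ∑ j, (x j : ℤ) = r' i, g x (d - x)) :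
    ∑ A ∈ tables r c with blockSum A S J = t, f (A i) (A i')
      ≤ ∑ A ∈ tables r' c with blockSum A S J = t, g (A i) (A i') := by
  -- Both families are slices, by the sum of row `i`, of one class closed under resampling.
  rw [← pairTables_filter r c (i := i) (i' := i'), ← pairTables_filter r' c (i := i) (i' := i')]
  have h1 : pairTables r' c i i' (r' i + r' i') S J t = pairTables r c i i' (r i + r i') S J t := by
    ext A
    rw [mem_pairTables, mem_pairTables, hrp]
    have : (∀ k, k ≠ i → k ≠ i' → ∑ j, A k j = r' k) ↔
        ∀ k, k ≠ i → k ≠ i' → ∑ j, A k j = r k :=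
      forall_congr' fun k => forall_congr' fun hk => forall_congr' fun hk' => by rw [hr k hk hk']
    rw [this]
  rw [h1, Finset.sum_filter, Finset.sum_filter]
  apply sum_le_sum_of_resample (pairTables r c i i' (r i + r i') S J t) hne
    (pairTables_closed hne hS) (fun x y => if ∑ j, x j = r i then f x y else 0)
    (fun x y => if ∑ j, x j = r' i then g x y else 0)
  intro A hA
  have h2 := hfg (A i + A i') (mem_pairTables.mp hA).1.2.1
  rw [Finset.sum_filter, Finset.sum_filter] at h2
  exact_mod_cast h2

theorem filter_blockSum_empty {ι κ : Type*} (s : Finset (ι → κ → ℕ)) :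
    {A ∈ s | blockSum A (∅ : Finset ι) (∅ : Finset κ) = 0} = s := by
  simp [blockSum]

/-- The version of `sum_tables_le_sum_tables` for two rows with equal sums. -/
theorem sum_tables_le_of_eq {r : ι → ℕ} {c : κ → ℕ} {i i' : ι} (hne : i ≠ i') {R : ℕ}
    (hi : r i = R) (hi' : r i' = R) (f g : (κ → ℕ) → (κ → ℕ) → ℝ)
    (hfg : ∀ d : κ → ℕ, ∑ j, d j = 2 * R →
      ∑ x ∈ box d with ∑ j, (x j : ℤ) = R, f x (d - x)
        ≤ ∑ x ∈ box d with ∑ j, (x j : ℤ) = R, g x (d - x)) :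
    ∑ A ∈ tables r c, f (A i) (A i') ≤ ∑ A ∈ tables r c, g (A i) (A i') := by
  have := sum_tables_le_sum_tables (r := r) (r' := r) (c := c) hne (fun _ _ _ => rfl) rfl
    (S := ∅) (by simp) (∅ : Finset κ) 0 f g
  rw [filter_blockSum_empty] at this
  apply this
  intro d hd
  rw [hi] at hd ⊢
  apply hfg d
  omega

/-! ### Moments of entries. -/

section Moments

/-- With d = A i + A i', one power of d j is traded for a factor `A i' j`, which can later be summed
over `i'` against the column margin. -/
theorem sum_tables_pow_succ_le {r : ι → ℕ} {c : κ → ℕ} {i i' : ι} (hne : i ≠ i') {R : ℕ}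
    (hi : r i = R) (hi' : r i' = R) (j : κ) (p : ℕ) :
    ∑ A ∈ tables r c, (A i j : ℝ) ^ (p + 1)
      ≤ 12 * 2 ^ p * ∑ A ∈ tables r c, (A i j : ℝ) ^ p * A i' j
        + 2 ^ p * ∑ A ∈ tables r c, ((A i j : ℝ) ^ p + (A i' j : ℝ) ^ p) := by
  have h := sum_tables_le_of_eq (c := c) hne hi hi' (fun x y => ((x j + y j : ℕ) : ℝ) ^ (p + 1))
    (fun x y => 12 * 2 ^ p * ((x j : ℝ) ^ p * y j) + ((x j + y j : ℕ) : ℝ) ^ p) ?_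
  · rw [Finset.mul_sum, Finset.mul_sum, ← Finset.sum_add_distrib]
    refine (Finset.sum_le_sum fun A _ => ?_).trans (h.trans (Finset.sum_le_sum fun A _ => ?_))
    · gcongr
      omega
    · have ha0 : (0 : ℝ) ≤ A i j := Nat.cast_nonneg _
      have hb0 : (0 : ℝ) ≤ A i' j := Nat.cast_nonneg _
      gcongr
      push_cast
      rcases le_total (A i j : ℝ) (A i' j) with hab | hab
      · calc ((A i j : ℝ) + A i' j) ^ p ≤ (2 * A i' j) ^ p := by gcongr; linarith
          _ = 2 ^ p * (A i' j : ℝ) ^ p := by rw [mul_pow]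
          _ ≤ _ := by gcongr; linarith [pow_nonneg ha0 p]
      · calc ((A i j : ℝ) + A i' j) ^ p ≤ (2 * A i j) ^ p := by gcongr; linarith
          _ = 2 ^ p * (A i j : ℝ) ^ p := by rw [mul_pow]
          _ ≤ _ := by gcongr; linarith [pow_nonneg hb0 p]
  · intro d hd
    have hadd : ∀ x ∈ {x ∈ box d | ∑ k, (x k : ℤ) = R}, x j + (d - x) j = d j := by
      intro x hx
      have := mem_box.mp (Finset.mem_filter.mp hx).1 j
      simp only [Pi.sub_apply]
      omega
    have hq : ∀ q : ℕ, ∑ x ∈ box d with ∑ k, (x k : ℤ) = R, ((x j + (d - x) j : ℕ) : ℝ) ^ q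
        = ∑ x ∈ box d with ∑ k, (x k : ℤ) = R, (d j : ℝ) ^ q := fun q =>
      Finset.sum_congr rfl fun x hx => by rw [hadd x hx]
    rw [Finset.sum_add_distrib, ← Finset.mul_sum, hq, hq]
    exact pow_succ_mul_boxCount_le d j hd p

/-- The `p`-th moments of the entries of column `j`, summed over rows in a group of rows with
equal margins. -/
theorem sum_sum_tables_pow_succ_le {r : ι → ℕ} {c : κ → ℕ} {G : Finset ι} (hG : 2 ≤ G.card)
    {R : ℕ} (hr : ∀ i ∈ G, r i = R) (j : κ) (p : ℕ) :
    ∑ i ∈ G, ∑ A ∈ tables r c, (A i j : ℝ) ^ (p + 1)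
      ≤ 12 * 2 ^ p * (c j / ((G.card : ℝ) - 1) + 1)
        * ∑ i ∈ G, ∑ A ∈ tables r c, (A i j : ℝ) ^ p := by
  set g : ℝ := (G.card : ℝ) - 1 with hg
  have hg1 : (1 : ℝ) ≤ g := by
    have : (2 : ℝ) ≤ G.card := by exact_mod_cast hG
    linarith
  have hcard : ∀ i ∈ G, ((G.erase i).card : ℝ) = g := by
    intro i hi
    rw [Finset.card_erase_of_mem hi, Nat.cast_sub (by omega)]
    simp [hg]
  have h1 : ∑ i ∈ G, ∑ i' ∈ G.erase i, ∑ A ∈ tables r c, (A i j : ℝ) ^ (p + 1)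
      ≤ ∑ i ∈ G, ∑ i' ∈ G.erase i, (12 * 2 ^ p * ∑ A ∈ tables r c, (A i j : ℝ) ^ p * A i' j
        + 2 ^ p * ∑ A ∈ tables r c, ((A i j : ℝ) ^ p + (A i' j : ℝ) ^ p)) := by
    refine Finset.sum_le_sum fun i hi => Finset.sum_le_sum fun i' hi' => ?_
    have hi'' := Finset.mem_erase.mp hi'
    exact sum_tables_pow_succ_le hi''.1.symm (hr i hi) (hr i' hi''.2) j p
  have h2 : ∑ i ∈ G, ∑ i' ∈ G.erase i, ∑ A ∈ tables r c, (A i j : ℝ) ^ (p + 1)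
      = g * ∑ i ∈ G, ∑ A ∈ tables r c, (A i j : ℝ) ^ (p + 1) := by
    rw [Finset.mul_sum]
    refine Finset.sum_congr rfl fun i hi => ?_
    rw [Finset.sum_const, nsmul_eq_mul, hcard i hi]
  -- For a fixed row `i`, the entries `A i' j` over the other rows add up to at most `c j`.
  have h3 : ∑ i ∈ G, ∑ i' ∈ G.erase i, ∑ A ∈ tables r c, (A i j : ℝ) ^ p * A i' j
      ≤ c j * ∑ i ∈ G, ∑ A ∈ tables r c, (A i j : ℝ) ^ p := by
    rw [Finset.mul_sum]
    refine Finset.sum_le_sum fun i hi => ?_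
    rw [Finset.sum_comm, Finset.mul_sum]
    refine Finset.sum_le_sum fun A hA => ?_
    rw [← Finset.mul_sum, mul_comm]
    gcongr
    rw [← (mem_tables.mp hA).2 j]
    push_cast
    exact Finset.sum_le_sum_of_subset_of_nonneg (Finset.subset_univ _) fun _ _ _ =>
      Nat.cast_nonneg _
  have h4 : ∑ i ∈ G, ∑ i' ∈ G.erase i, ∑ A ∈ tables r c, ((A i j : ℝ) ^ p + (A i' j : ℝ) ^ p)
      ≤ 2 * g * ∑ i ∈ G, ∑ A ∈ tables r c, (A i j : ℝ) ^ p := by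
    simp_rw [Finset.sum_add_distrib]
    have h5 : ∑ i ∈ G, ∑ i' ∈ G.erase i, ∑ A ∈ tables r c, (A i j : ℝ) ^ p
        = g * ∑ i ∈ G, ∑ A ∈ tables r c, (A i j : ℝ) ^ p := by
      rw [Finset.mul_sum]
      refine Finset.sum_congr rfl fun i hi => ?_
      rw [Finset.sum_const, nsmul_eq_mul, hcard i hi]
    have h6 : ∑ i ∈ G, ∑ i' ∈ G.erase i, ∑ A ∈ tables r c, (A i' j : ℝ) ^ p
        = g * ∑ i ∈ G, ∑ A ∈ tables r c, (A i j : ℝ) ^ p := by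
      rw [← h5]
      apply Finset.sum_comm'
      intro x y
      simp only [Finset.mem_erase]
      tauto
    rw [h5, h6]
    linarith
  rw [h2] at h1
  have h0 : ∑ i ∈ G, ∑ i' ∈ G.erase i, (12 * 2 ^ p * ∑ A ∈ tables r c, (A i j : ℝ) ^ p * A i' j
        + 2 ^ p * ∑ A ∈ tables r c, ((A i j : ℝ) ^ p + (A i' j : ℝ) ^ p))
      = 12 * 2 ^ p * (∑ i ∈ G, ∑ i' ∈ G.erase i, ∑ A ∈ tables r c, (A i j : ℝ) ^ p * A i' j)
        + 2 ^ p * ∑ i ∈ G, ∑ i' ∈ G.erase i,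
          ∑ A ∈ tables r c, ((A i j : ℝ) ^ p + (A i' j : ℝ) ^ p) := by
    simp only [Finset.sum_add_distrib, Finset.mul_sum, mul_add]
  rw [h0] at h1
  have hQ : 0 ≤ ∑ i ∈ G, ∑ A ∈ tables r c, (A i j : ℝ) ^ p :=
    Finset.sum_nonneg fun _ _ => Finset.sum_nonneg fun _ _ => by positivity
  have h7 : g * ∑ i ∈ G, ∑ A ∈ tables r c, (A i j : ℝ) ^ (p + 1)
      ≤ g * (12 * 2 ^ p * (c j / g + 1) * ∑ i ∈ G, ∑ A ∈ tables r c, (A i j : ℝ) ^ p) := by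
    have h8 : g * (12 * 2 ^ p * (c j / g + 1) * ∑ i ∈ G, ∑ A ∈ tables r c, (A i j : ℝ) ^ p)
        = 12 * 2 ^ p * (c j * ∑ i ∈ G, ∑ A ∈ tables r c, (A i j : ℝ) ^ p)
          + 2 ^ p * (12 * g * ∑ i ∈ G, ∑ A ∈ tables r c, (A i j : ℝ) ^ p) := by
      field_simp
    rw [h8]
    refine h1.trans (add_le_add (by gcongr) ?_)
    gcongr
    refine h4.trans ?_
    gcongr
    norm_num
  exact le_of_mul_le_mul_left h7 (by linarith)

theorem sum_sum_tables_pow_le {r : ι → ℕ} {c : κ → ℕ} {G : Finset ι} (hG : 2 ≤ G.card)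
    {R : ℕ} (hr : ∀ i ∈ G, r i = R) (j : κ) (p : ℕ) :
    ∑ i ∈ G, ∑ A ∈ tables r c, (A i j : ℝ) ^ p
      ≤ (12 * 2 ^ p * (c j / ((G.card : ℝ) - 1) + 1)) ^ p * (G.card * (tables r c).card) := by
  have hb : (0 : ℝ) ≤ c j / ((G.card : ℝ) - 1) + 1 := by
    have : (2 : ℝ) ≤ G.card := by exact_mod_cast hG
    have : (0 : ℝ) ≤ c j / ((G.card : ℝ) - 1) := div_nonneg (by positivity) (by linarith)
    linarith
  induction p with
  | zero => simp
  | succ p ih =>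
    refine (sum_sum_tables_pow_succ_le hG hr j p).trans ?_
    set b : ℝ := c j / ((G.card : ℝ) - 1) + 1
    have h2 : 12 * 2 ^ p * b ≤ 12 * 2 ^ (p + 1) * b := by
      gcongr <;> norm_num
    calc _ ≤ 12 * 2 ^ p * b * ((12 * 2 ^ p * b) ^ p * (G.card * (tables r c).card)) := by gcongr
      _ ≤ 12 * 2 ^ (p + 1) * b
          * ((12 * 2 ^ (p + 1) * b) ^ p * (G.card * (tables r c).card)) := by gcongr
      _ = _ := by ring

/-- Markov's inequality for the p-th moment, with a union bound over the block. -/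
theorem card_tables_large_entry_le {r : ι → ℕ} {c : κ → ℕ} {G : Finset ι} (hG : 2 ≤ G.card)
    {R : ℕ} (hr : ∀ i ∈ G, r i = R) (J : Finset κ) {c₀ : ℕ} (hc : ∀ j ∈ J, c j = c₀) (p : ℕ)
    {L : ℝ} (hL : 0 < L) :
    ({A ∈ tables r c | ∃ i ∈ G, ∃ j ∈ J, L ≤ A i j}.card : ℝ)
      ≤ (12 * 2 ^ p * (c₀ / ((G.card : ℝ) - 1) + 1) / L) ^ p
        * (J.card * G.card * (tables r c).card) := by
  have h1 : ({A ∈ tables r c | ∃ i ∈ G, ∃ j ∈ J, L ≤ A i j}.card : ℝ) * L ^ p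
      ≤ ∑ j ∈ J, ∑ i ∈ G, ∑ A ∈ tables r c, (A i j : ℝ) ^ p := by
    have h2 : ∀ A : ι → κ → ℕ, (0 : ℝ) ≤ ∑ j ∈ J, ∑ i ∈ G, (A i j : ℝ) ^ p := fun A =>
      Finset.sum_nonneg fun _ _ => Finset.sum_nonneg fun _ _ => by positivity
    have h3 : ∑ j ∈ J, ∑ i ∈ G, ∑ A ∈ tables r c, (A i j : ℝ) ^ p
        = ∑ A ∈ tables r c, ∑ j ∈ J, ∑ i ∈ G, (A i j : ℝ) ^ p := by
      rw [Finset.sum_comm]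
      refine (Finset.sum_congr rfl fun i _ => Finset.sum_comm).trans ?_
      rw [Finset.sum_comm]
      exact Finset.sum_congr rfl fun A _ => Finset.sum_comm
    rw [h3, ← nsmul_eq_mul, ← Finset.sum_const]
    refine (Finset.sum_le_sum fun A hA => ?_).trans
      (Finset.sum_le_sum_of_subset_of_nonneg (Finset.filter_subset _ _) fun A _ _ => h2 A)
    obtain ⟨i, hi, j, hj, hij⟩ := (Finset.mem_filter.mp hA).2
    calc L ^ p ≤ (A i j : ℝ) ^ p := by gcongr
      _ ≤ ∑ i ∈ G, (A i j : ℝ) ^ p :=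
        Finset.single_le_sum (f := fun i => (A i j : ℝ) ^ p) (fun _ _ => by positivity) hi
      _ ≤ _ := Finset.single_le_sum (f := fun j => ∑ i ∈ G, (A i j : ℝ) ^ p)
        (fun _ _ => Finset.sum_nonneg fun _ _ => by positivity) hj
  have h2 : ∑ j ∈ J, ∑ i ∈ G, ∑ A ∈ tables r c, (A i j : ℝ) ^ p
      ≤ J.card * ((12 * 2 ^ p * (c₀ / ((G.card : ℝ) - 1) + 1)) ^ p
        * (G.card * (tables r c).card)) := by
    rw [← nsmul_eq_mul]
    refine Finset.sum_le_card_nsmul _ _ _ fun j hj => ?_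
    have := sum_sum_tables_pow_le (c := c) hG hr j p
    rwa [hc j hj] at this
  rw [div_pow, div_mul_eq_mul_div, le_div_iff₀ (by positivity)]
  refine (h1.trans h2).trans (le_of_eq ?_)
  ring

end Moments

/-! ### Comparison of rows with equal margins. -/

section Deviation

/-- The condition involving V depends only on the sum of the two rows. It is thus constant under
resampling: either the box bound applies or the event is empty. -/
theorem card_tables_deviation_le {r : ι → ℕ} {c : κ → ℕ} {i i' : ι} (hne : i ≠ i') {R : ℕ}
    (hi : r i = R) (hi' : r i' = R) (J : Finset κ) {V τ : ℝ} (hV : 0 < V) (hτ : 0 ≤ τ) :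
    ({A ∈ tables r c | τ ≤ |∑ j ∈ J, (A i j : ℝ) - ∑ j ∈ J, (A i' j : ℝ)| ∧
        ∑ j ∈ J, ((A i j : ℝ) + A i' j) ^ 2 ≤ V}.card : ℝ)
      ≤ 2 * Real.exp (-(τ ^ 2 / (2 * V))) * (2 * R + 1) * (tables r c).card := by
  have h := sum_tables_le_of_eq (c := c) hne hi hi'
    (fun x y => if τ ≤ |∑ j ∈ J, (x j : ℝ) - ∑ j ∈ J, (y j : ℝ)| ∧
        ∑ j ∈ J, ((x j : ℝ) + y j) ^ 2 ≤ V then 1 else 0)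
    (fun x y => 2 * Real.exp (-(τ ^ 2 / (2 * V))) * (2 * R + 1)) ?_
  · rw [Finset.sum_const, nsmul_eq_mul, ← Finset.sum_filter, Finset.sum_const, nsmul_eq_mul,
      mul_one, mul_comm] at h
    rw [mul_comm]
    rw [mul_comm] at h
    rw [mul_comm]
    rwa [mul_comm (_ * _ : ℝ)]
  · intro d hd
    rw [Finset.sum_const, nsmul_eq_mul, ← Finset.sum_filter, Finset.sum_const, nsmul_eq_mul,
      mul_one, mul_comm (_ : ℝ)]
    have hcast : ∀ x ∈ box d, ∀ j, (((d - x) j : ℕ) : ℝ) = d j - x j := by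
      intro x hx j
      rw [Pi.sub_apply, Nat.cast_sub (mem_box.mp hx j)]
    by_cases hdV : ∑ j ∈ J, (d j : ℝ) ^ 2 ≤ V
    · refine le_trans ?_ (card_box_deviation_le_boxCount d J hV hτ hdV hd)
      gcongr
      intro x hx
      simp only [Finset.mem_filter] at hx ⊢
      refine ⟨hx.1.1, hx.2.1.trans (le_of_eq ?_)⟩
      rw [← Finset.sum_sub_distrib]
      congr 1
      refine Finset.sum_congr rfl fun j _ => ?_
      rw [hcast x hx.1.1]
      ring
    · rw [Finset.card_eq_zero.mpr]
      · simp only [Nat.cast_zero]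
        positivity
      · rw [Finset.filter_eq_empty_iff]
        intro x hx hx2
        apply hdV
        refine le_trans (le_of_eq (Finset.sum_congr rfl fun j _ => ?_)) hx2.2
        rw [hcast x (Finset.mem_filter.mp hx).1]
        ring

/-- Rows with equal margins have nearly equal sums over the columns in `J`, unless a large entry
occurs. -/
theorem card_tables_row_deviation_le {r : ι → ℕ} {c : κ → ℕ} {G : Finset ι} {R : ℕ}
    (hr : ∀ i ∈ G, r i = R) {i₀ : ι} (hi₀ : i₀ ∈ G) (J : Finset κ) {L τ : ℝ} (hL : 0 < L)
    (hR : 0 < R) (hτ : 0 < τ) :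
    ({A ∈ tables r c | (∃ i ∈ G, τ ≤ |∑ j ∈ J, (A i₀ j : ℝ) - ∑ j ∈ J, (A i j : ℝ)|) ∧
        ∀ i ∈ G, ∀ j ∈ J, (A i j : ℝ) < L}.card : ℝ)
      ≤ G.card * (2 * Real.exp (-(τ ^ 2 / (8 * L * R))) * (2 * R + 1) * (tables r c).card) := by
  have hR' : (0 : ℝ) < R := by exact_mod_cast hR
  have hsub : {A ∈ tables r c | (∃ i ∈ G, τ ≤ |∑ j ∈ J, (A i₀ j : ℝ) - ∑ j ∈ J, (A i j : ℝ)|) ∧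
        ∀ i ∈ G, ∀ j ∈ J, (A i j : ℝ) < L}
      ⊆ (G.erase i₀).biUnion fun i => {A ∈ tables r c |
        τ ≤ |∑ j ∈ J, (A i₀ j : ℝ) - ∑ j ∈ J, (A i j : ℝ)| ∧
        ∑ j ∈ J, ((A i₀ j : ℝ) + A i j) ^ 2 ≤ 4 * L * R} := by
    intro A hA
    obtain ⟨hA, ⟨i, hi, hdev⟩, hlt⟩ := Finset.mem_filter.mp hA
    have hne : i ≠ i₀ := by
      rintro rfl
      simp at hdev
      linarith
    rw [Finset.mem_biUnion]
    refine ⟨i, Finset.mem_erase.mpr ⟨hne, hi⟩, Finset.mem_filter.mpr ⟨hA, hdev, ?_⟩⟩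
    have hrow : ∀ k ∈ G, ∑ j ∈ J, (A k j : ℝ) ≤ R := by
      intro k hk
      rw [← hr k hk, ← (mem_tables.mp hA).1 k]
      push_cast
      exact Finset.sum_le_sum_of_subset_of_nonneg (Finset.subset_univ _) fun _ _ _ =>
        Nat.cast_nonneg _
    -- Entries below L turn the sum of squares into 2L times a linear sum, which is at most 2R.
    calc ∑ j ∈ J, ((A i₀ j : ℝ) + A i j) ^ 2
        ≤ ∑ j ∈ J, 2 * L * ((A i₀ j : ℝ) + A i j) := by
          refine Finset.sum_le_sum fun j hj => ?_
          rw [sq]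
          gcongr
          linarith [hlt i₀ hi₀ j hj, hlt i hi j hj]
      _ = 2 * L * (∑ j ∈ J, (A i₀ j : ℝ) + ∑ j ∈ J, (A i j : ℝ)) := by
          rw [← Finset.mul_sum, Finset.sum_add_distrib]
      _ ≤ 2 * L * (R + R) := by
          gcongr
          · exact hrow i₀ hi₀
          · exact hrow i hi
      _ = _ := by ring
  have h1 := (Finset.card_le_card hsub).trans Finset.card_biUnion_le
  have h2 : ∀ i ∈ G.erase i₀, ({A ∈ tables r c |
        τ ≤ |∑ j ∈ J, (A i₀ j : ℝ) - ∑ j ∈ J, (A i j : ℝ)| ∧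
        ∑ j ∈ J, ((A i₀ j : ℝ) + A i j) ^ 2 ≤ 4 * L * R}.card : ℝ)
      ≤ 2 * Real.exp (-(τ ^ 2 / (8 * L * R))) * (2 * R + 1) * (tables r c).card := by
    intro i hi
    have hi' := Finset.mem_erase.mp hi
    have := card_tables_deviation_le (c := c) hi'.1.symm (hr i₀ hi₀) (hr i hi'.2) J
      (V := 4 * L * R) (by positivity) hτ.le
    rwa [show 2 * (4 * L * R) = 8 * L * R by ring] at this
  calc _ ≤ ∑ i ∈ G.erase i₀, ({A ∈ tables r c |
        τ ≤ |∑ j ∈ J, (A i₀ j : ℝ) - ∑ j ∈ J, (A i j : ℝ)| ∧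
        ∑ j ∈ J, ((A i₀ j : ℝ) + A i j) ^ 2 ≤ 4 * L * R}.card : ℝ) := by exact_mod_cast h1
    _ ≤ _ := Finset.sum_le_card_nsmul _ _ _ h2
    _ ≤ _ := by
      rw [nsmul_eq_mul]
      gcongr
      exact Finset.erase_subset _ _

end Deviation

/-! ### Balanced margins maximise the number of tables. -/

section Balance

/-- The number of tables with row sums `r`, column sums `c` and block sum `t` in `S × J`. -/
def tableCount (r : ι → ℕ) (c : κ → ℕ) (S : Finset ι) (J : Finset κ) (t : ℕ) : ℕ :=
  {A ∈ tables r c | blockSum A S J = t}.card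

/-- Resampling with the constant function 1: the new margin of row `i` is at least as close to half
the pair total, where the box count peaks. -/
theorem tableCount_le_of_pair {r r' : ι → ℕ} {c : κ → ℕ} {i i' : ι} (hne : i ≠ i')
    (hr : ∀ k, k ≠ i → k ≠ i' → r k = r' k) (hrp : r i + r i' = r' i + r' i')
    {S : Finset ι} (hS : i ∈ S ↔ i' ∈ S) (J : Finset κ) (t : ℕ)
    (hb : |(r' i : ℤ) - r' i'| ≤ |(r i : ℤ) - r i'|) :
    tableCount r c S J t ≤ tableCount r' c S J t := by
  have h := sum_tables_le_sum_tables (c := c) hne hr hrp hS J t (fun _ _ => 1) (fun _ _ => 1) ?_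
  · simp only [Finset.sum_const, nsmul_eq_mul, mul_one] at h
    exact_mod_cast h
  · intro d hd
    simp only [Finset.sum_const, nsmul_eq_mul, mul_one]
    have := boxCount_centerUnimodal d (r' i) (r i) ?_
    · unfold boxCount at this
      exact_mod_cast this
    · rw [hd]
      push_cast
      rw [show 2 * (r' i : ℤ) - (r i + r i') = r' i - r' i' by omega,
        show 2 * (r i : ℤ) - (r i + r i') = r i - r i' by ring]
      exact hb

/-- Among row margins with prescribed group sums, the constant ones maximise the number of
tables. -/
theorem tableCount_le_of_rows {r q : ι → ℕ} {c : κ → ℕ} {S : Finset ι} (J : Finset κ) (t : ℕ)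
    (hr : ∀ k l, (k ∈ S ↔ l ∈ S) → r k = r l) (hS : ∑ k ∈ S, q k = ∑ k ∈ S, r k)
    (hS' : ∑ k ∈ Sᶜ, q k = ∑ k ∈ Sᶜ, r k) :
    tableCount q c S J t ≤ tableCount r c S J t := by
  induction hN : {k | q k ≠ r k}.toFinset.card using Nat.strong_induction_on generalizing q with
  | _ N ih =>
    by_cases h : ∃ k, q k ≠ r k
    · have hpair : ∃ i i', (i ∈ S ↔ i' ∈ S) ∧ r i < q i ∧ q i' < r i' := by
        obtain ⟨k, hk⟩ := h
        obtain ⟨G, hkG, hG, hcl⟩ : ∃ G : Finset ι, k ∈ G ∧ ∑ k ∈ G, q k = ∑ k ∈ G, r k ∧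
            ∀ l ∈ G, (k ∈ S ↔ l ∈ S) := by
          by_cases hkS : k ∈ S
          · exact ⟨S, hkS, hS, fun l hl => by simp [hkS, hl]⟩
          · exact ⟨Sᶜ, by simpa using hkS, hS', fun l hl => by simp_all⟩
        rcases lt_or_gt_of_ne hk with hlt | hlt
        · obtain ⟨l, hl, hl'⟩ : ∃ l ∈ G, r l < q l := by
            by_contra! hcon
            exact (Finset.sum_lt_sum hcon ⟨k, hkG, hlt⟩).ne hG
          exact ⟨l, k, (hcl l hl).symm, hl', hlt⟩
        · obtain ⟨l, hl, hl'⟩ : ∃ l ∈ G, q l < r l := by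
            by_contra! hcon
            exact (Finset.sum_lt_sum hcon ⟨k, hkG, hlt⟩).ne' hG
          exact ⟨k, l, hcl l hl, hlt, hl'⟩
      obtain ⟨i, i', hii, hi, hi'⟩ := hpair
      have hne : i ≠ i' := by rintro rfl; omega
      have hreq := hr i i' hii
      -- Row `i` receives its target and its surplus goes to row `i'`. Both new margins lie between
      -- `q i'` and `q i`, so their gap does not grow, and fewer rows differ from `r`.
      set q' : ι → ℕ := Function.update (Function.update q i (r i)) i' (q i + q i' - r i) with hq'
      have hq'i : q' i = r i := by simp [hq', hne]
      have hq'i' : q' i' = q i + q i' - r i := by simp [hq']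
      have hq'k : ∀ k, k ≠ i → k ≠ i' → q' k = q k := fun k hk hk' => by simp [hq', hk, hk']
      have hp : q' i + q' i' = q i + q i' := by omega
      refine (tableCount_le_of_pair hne (fun k hk hk' => (hq'k k hk hk').symm) hp.symm hii J t
        ?_).trans (ih _ ?_ ?_ ?_ rfl)
      · rw [hq'i, hq'i', Nat.cast_sub (by omega)]
        push_cast
        rw [abs_of_nonneg (a := (q i : ℤ) - q i') (by omega), abs_le]
        constructor <;> omega
      · rw [← hN]
        apply Finset.card_lt_card
        rw [Finset.ssubset_iff_of_subset]
        · exact ⟨i, by simpa using hi.ne', by simp [hq'i]⟩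
        · intro k
          simp only [Set.mem_toFinset, Set.mem_ofPred_eq]
          by_cases hk : k = i
          · subst hk; simp [hq'i]
          · by_cases hk' : k = i'
            · subst hk'; intro _; exact hi'.ne
            · rw [hq'k k hk hk']; exact id
      · rw [← hS]; exact sum_eq_of_pair_eq hne hii hq'k hp
      · rw [← hS']
        exact sum_eq_of_pair_eq hne (by simp [hii]) hq'k hp
    · push Not at h
      rw [show q = r from funext h]

theorem tableCount_swap (r : ι → ℕ) (c : κ → ℕ) (S : Finset ι) (J : Finset κ) (t : ℕ) :
    tableCount r c S J t = tableCount c r J S t := by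
  refine Finset.card_nbij' (fun A j i => A i j) (fun A i j => A j i) ?_ ?_ ?_ ?_
  · intro A hA
    simp only [Finset.coe_filter, Set.mem_ofPred_eq, mem_tables] at hA ⊢
    refine ⟨hA.1.symm, ?_⟩
    rw [← hA.2, blockSum, blockSum, Finset.sum_comm]
  · intro A hA
    simp only [Finset.coe_filter, Set.mem_ofPred_eq, mem_tables] at hA ⊢
    refine ⟨hA.1.symm, ?_⟩
    rw [← hA.2, blockSum, blockSum, Finset.sum_comm]
  · intro A _; rfl
  · intro A _; rfl

theorem tableCount_le_of_margins {r q : ι → ℕ} {c e : κ → ℕ} {S : Finset ι} {J : Finset κ} (t : ℕ)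
    (hr : ∀ k l, (k ∈ S ↔ l ∈ S) → r k = r l) (hS : ∑ k ∈ S, q k = ∑ k ∈ S, r k)
    (hS' : ∑ k ∈ Sᶜ, q k = ∑ k ∈ Sᶜ, r k)
    (hc : ∀ k l, (k ∈ J ↔ l ∈ J) → c k = c l) (hJ : ∑ k ∈ J, e k = ∑ k ∈ J, c k)
    (hJ' : ∑ k ∈ Jᶜ, e k = ∑ k ∈ Jᶜ, c k) :
    tableCount q e S J t ≤ tableCount r c S J t := by
  refine (tableCount_le_of_rows J t hr hS hS').trans ?_
  rw [tableCount_swap, tableCount_swap r]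
  exact tableCount_le_of_rows S t hc hJ hJ'

end Balance

/-! ### Matrices with prescribed block sums. -/

section Block

theorem natCard_sum_eq (β : Type*) [Fintype β] (n : ℕ) :
    Nat.card {f : β → ℕ // ∑ b, f b = n} = (Fintype.card β).multichoose n := by
  classical
  rw [← Sym.card_sym_eq_multichoose, ← Nat.card_eq_fintype_card]
  exact Nat.card_congr (Sym.equivNatSumOfFintype β n).symm

/-- The colour classes are filled independently, each by stars and bars. -/
theorem natCard_fiber_sum_eq {α γ : Type*} [Fintype α] [Fintype γ] [DecidableEq γ] (col : α → γ)
    (s : γ → ℕ) :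
    Nat.card {f : α → ℕ // ∀ c, ∑ a with col a = c, f a = s c}
      = ∏ c, (Finset.card {a | col a = c}).multichoose (s c) := by
  let e : (α → ℕ) ≃ ((c : γ) → {a // col a = c} → ℕ) :=
    ((Equiv.sigmaFiberEquiv col).arrowCongr (Equiv.refl ℕ)).symm.trans 
      (Equiv.piCurry fun (c : γ) (_ : {a // col a = c}) => ℕ)
  have h1 : Nat.card {f : α → ℕ // ∀ c, ∑ a with col a = c, f a = s c}
      = Nat.card {g : (c : γ) → {a // col a = c} → ℕ // ∀ c, ∑ a, g c a = s c} := by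
    refine Nat.card_congr (e.subtypeEquiv fun f => forall_congr' fun c => ?_)
    rw [Finset.sum_subtype (p := fun a => col a = c) _ (by simp)]
    rfl
  rw [h1, Nat.card_congr (Equiv.subtypePiEquivPi
    (p := fun c (h : {a // col a = c} → ℕ) => ∑ a, h a = s c)), Nat.card_pi]
  refine Finset.prod_congr rfl fun c _ => ?_
  rw [natCard_sum_eq, Fintype.card_subtype]

/-- The matrices with prescribed block sums. -/
def blockFiber (S : Finset ι) (J : Finset κ) (t u u' v : ℕ) : Finset (ι → κ → ℕ) :=
  {A ∈ Fintype.piFinset fun _ : ι => box fun _ : κ => t + u + u' + v |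
    blockSum A S J = t ∧ blockSum A S Jᶜ = u ∧ blockSum A Sᶜ J = u' ∧ blockSum A Sᶜ Jᶜ = v}

theorem blockSum_add_compl {ι κ : Type*} [Fintype κ] [DecidableEq κ] (A : ι → κ → ℕ) (S : Finset ι) (J : Finset κ) :
    blockSum A S J + blockSum A S Jᶜ = ∑ i ∈ S, ∑ j, A i j := by
  simp_rw [blockSum, ← Finset.sum_add_distrib, Finset.sum_add_sum_compl]

theorem blockSum_add_compl' {ι κ : Type*} [Fintype ι] [DecidableEq ι] (A : ι → κ → ℕ) (S : Finset ι) (J : Finset κ) :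
    blockSum A S J + blockSum A Sᶜ J = ∑ j ∈ J, ∑ i, A i j := by
  rw [blockSum, blockSum, Finset.sum_add_sum_compl, Finset.sum_comm]

theorem mem_blockFiber {S : Finset ι} {J : Finset κ} {t u u' v : ℕ} {A : ι → κ → ℕ} :
    A ∈ blockFiber S J t u u' v ↔
      blockSum A S J = t ∧ blockSum A S Jᶜ = u ∧ blockSum A Sᶜ J = u' ∧ blockSum A Sᶜ Jᶜ = v := by
  simp only [blockFiber, Finset.mem_filter, Fintype.mem_piFinset, and_iff_right_iff_imp, mem_box]
  rintro ⟨h1, h2, h3, h4⟩ i j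
  have h5 := blockSum_add_compl A S J
  have h6 := blockSum_add_compl A Sᶜ J
  have h7 := Finset.sum_add_sum_compl S fun i => ∑ j, A i j
  have h8 : A i j ≤ ∑ j, A i j :=
    Finset.single_le_sum (f := fun j => A i j) (fun _ _ => Nat.zero_le _) (Finset.mem_univ j)
  have h9 : ∑ j, A i j ≤ ∑ i, ∑ j, A i j :=
    Finset.single_le_sum (f := fun i => ∑ j, A i j) (fun _ _ => Nat.zero_le _) (Finset.mem_univ i)
  omega

theorem card_blockFiber (S : Finset ι) (J : Finset κ) (t u u' v : ℕ) :
    (blockFiber S J t u u' v).card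
      = (S.card * J.card).multichoose t * (S.card * Jᶜ.card).multichoose u
        * ((Sᶜ.card * J.card).multichoose u' * (Sᶜ.card * Jᶜ.card).multichoose v) := by
  let col : ι × κ → Bool × Bool := fun a => (decide (a.1 ∈ S), decide (a.2 ∈ J))
  let s : Bool × Bool → ℕ := fun b => bif b.1 then (bif b.2 then t else u)
    else (bif b.2 then u' else v)
  have hcol : ∀ b : Bool × Bool, Finset.univ.filter (fun a => col a = b)
      = (bif b.1 then S else Sᶜ) ×ˢ (bif b.2 then J else Jᶜ) := by
    rintro ⟨b1, b2⟩
    ext ⟨i, j⟩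
    cases b1 <;> cases b2 <;> simp [col]
  have h := natCard_fiber_sum_eq col s
  have h1 : (blockFiber S J t u u' v).card
      = Nat.card {f : ι × κ → ℕ // ∀ c, ∑ a with col a = c, f a = s c} := by
    rw [← Fintype.card_coe, ← Nat.card_eq_fintype_card]
    refine Nat.card_congr ((Equiv.curry ι κ ℕ).symm.subtypeEquiv fun A => ?_)
    have hsum : ∀ b : Bool × Bool, ∑ a with col a = b, (Equiv.curry ι κ ℕ).symm A a
        = blockSum A (bif b.1 then S else Sᶜ) (bif b.2 then J else Jᶜ) := by
      intro b
      rw [hcol, Finset.sum_product]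
      rfl
    simp only [hsum, mem_blockFiber, Prod.forall, Bool.forall_bool, cond_true, cond_false, s]
    tauto
  rw [h1, h, Fintype.prod_prod_type]
  simp only [hcol, Finset.card_product, Fintype.prod_bool, cond_true, cond_false, s]

theorem tableCount_le_card_blockFiber {r : ι → ℕ} {c : κ → ℕ} {S : Finset ι} {J : Finset κ}
    {t u u' v : ℕ} (hS : ∑ k ∈ S, r k = t + u) (hS' : ∑ k ∈ Sᶜ, r k = u' + v)
    (hJ : ∑ k ∈ J, c k = t + u') :
    tableCount r c S J t ≤ (blockFiber S J t u u' v).card := by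
  apply Finset.card_le_card
  intro A hA
  obtain ⟨hA, ht⟩ := Finset.mem_filter.mp hA
  rw [mem_tables] at hA
  have h5 := blockSum_add_compl A S J
  have h6 := blockSum_add_compl A Sᶜ J
  have h7 := blockSum_add_compl' A S J
  simp_rw [hA.1] at h5 h6
  simp_rw [hA.2] at h7
  rw [mem_blockFiber]
  omega

/-- Sort the matrices by their margin vectors. Every margin is at most the total, which bounds the
number of classes, and by balancing no class exceeds the one with margins constant on groups. -/
theorem card_blockFiber_le {r : ι → ℕ} {c : κ → ℕ} {S : Finset ι} {J : Finset κ}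
    {t u u' v : ℕ} (hr : ∀ k l, (k ∈ S ↔ l ∈ S) → r k = r l)
    (hc : ∀ k l, (k ∈ J ↔ l ∈ J) → c k = c l)
    (hS : ∑ k ∈ S, r k = t + u) (hS' : ∑ k ∈ Sᶜ, r k = u' + v)
    (hJ : ∑ k ∈ J, c k = t + u') (hJ' : ∑ k ∈ Jᶜ, c k = u + v) :
    (blockFiber S J t u u' v).card
      ≤ (t + u + u' + v + 1) ^ (Fintype.card ι + Fintype.card κ) * tableCount r c S J t := by
  set M := t + u + u' + v with hM
  let T : Finset ((ι → ℕ) × (κ → ℕ)) := box (fun _ : ι => M) ×ˢ box (fun _ : κ => M)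
  have hT : T.card = (M + 1) ^ (Fintype.card ι + Fintype.card κ) := by
    simp [T, box, pow_add]
  rw [← hT, Finset.card_eq_sum_card_fiberwise
    (f := fun A => ((fun i => ∑ j, A i j), (fun j => ∑ i, A i j))) (t := T)]
  · refine Finset.sum_le_card_nsmul _ _ _ fun p _ => ?_
    by_cases hne : {A ∈ blockFiber S J t u u' v |
        ((fun i => ∑ j, A i j), (fun j => ∑ i, A i j)) = p}.Nonempty
    · obtain ⟨A, hA⟩ := hne
      obtain ⟨hA, hp⟩ := Finset.mem_filter.mp hA
      obtain ⟨h1, h2, h3, h4⟩ := mem_blockFiber.mp hA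
      have hp1 : ∀ i, ∑ j, A i j = p.1 i := fun i => congrFun (congrArg Prod.fst hp) i
      have hp2 : ∀ j, ∑ i, A i j = p.2 j := fun j => congrFun (congrArg Prod.snd hp) j
      have h5 := blockSum_add_compl A S J
      have h6 := blockSum_add_compl A Sᶜ J
      have h7 := blockSum_add_compl' A S J
      have h8 := blockSum_add_compl' A S Jᶜ
      simp_rw [hp1] at h5 h6
      simp_rw [hp2] at h7 h8
      refine le_trans ?_ (tableCount_le_of_margins (q := p.1) (e := p.2) t hr (by omega) (by omega)
        hc (by omega) (by omega))
      apply Finset.card_le_card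
      intro B hB
      obtain ⟨hB, hpB⟩ := Finset.mem_filter.mp hB
      rw [Finset.mem_filter, mem_tables]
      exact ⟨⟨fun i => congrFun (congrArg Prod.fst hpB) i,
        fun j => congrFun (congrArg Prod.snd hpB) j⟩, (mem_blockFiber.mp hB).1⟩
    · rw [Finset.not_nonempty_iff_eq_empty.mp hne]
      simp
  · intro A hA
    obtain ⟨h1, h2, h3, h4⟩ := mem_blockFiber.mp hA
    have h5 := blockSum_add_compl A S J
    have h6 := blockSum_add_compl A Sᶜ J
    have h7 := Finset.sum_add_sum_compl S fun i => ∑ j, A i j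
    simp only [T, Finset.coe_product, Set.mem_prod, Finset.mem_coe, mem_box]
    constructor
    · intro i
      have := Finset.single_le_sum (f := fun i => ∑ j, A i j) (fun _ _ => Nat.zero_le _)
        (Finset.mem_univ i)
      omega
    · intro j
      have := Finset.single_le_sum (f := fun j => ∑ i, A i j) (fun _ _ => Nat.zero_le _)
        (Finset.mem_univ j)
      rw [Finset.sum_comm] at this
      omega

end Block

end Tables

/-! ### Ratios of multiset counts and geometric decay. -/

theorem multichoose_succ_mul (k t : ℕ) :
    k.multichoose (t + 1) * (t + 1) = k.multichoose t * (k + t) := by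
  rcases k with _ | k
  · rcases t with _ | t <;> simp
  · rw [Nat.multichoose_eq, Nat.multichoose_eq, show k + 1 + (t + 1) - 1 = k + t + 1 by omega,
      show k + 1 + t - 1 = k + t by omega, ← Nat.add_one_mul_choose_eq]
    ring

section Geometric

variable {F : ℕ → ℝ} {κ : ℝ} {t₁ W : ℕ}

theorem le_pow_mul_of_ratio_le (hκ : 0 ≤ κ)
    (h : ∀ t, t₁ ≤ t → t < W → F (t + 1) ≤ κ * F t) {t : ℕ} (ht : t₁ ≤ t) (htW : t ≤ W) :
    F t ≤ κ ^ (t - t₁) * F t₁ := by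
  induction t, ht using Nat.le_induction with
  | base => simp
  | succ t ht ih =>
    refine (h t ht (by omega)).trans ?_
    rw [Nat.succ_sub ht, pow_succ', mul_assoc]
    exact mul_le_mul_of_nonneg_left (ih (by omega)) hκ

theorem le_pow_mul_of_le_ratio (hκ : 0 ≤ κ)
    (h : ∀ t, t < t₁ → F t ≤ κ * F (t + 1)) {t : ℕ} (ht : t ≤ t₁) :
    F t ≤ κ ^ (t₁ - t) * F t₁ := by
  induction ht using Nat.decreasingInduction with
  | self => simp
  | of_succ t ht ih =>
    refine (h t ht).trans ?_
    rw [show t₁ - t = t₁ - (t + 1) + 1 by omega, pow_succ', mul_assoc]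
    exact mul_le_mul_of_nonneg_left ih hκ

end Geometric

/-! ### Tables with two classes of margins: the law of the special block sum. -/

section TwoClass

variable {ι : Type*} [Fintype ι] [DecidableEq ι] {r : ι → ℕ} {S : Finset ι} {R q : ℕ}

theorem sum_class_eq (hr : ∀ k ∈ S, r k = R) (hr' : ∀ k ∉ S, r k = q) :
    ∑ k ∈ S, r k = S.card * R ∧ ∑ k ∈ Sᶜ, r k = Sᶜ.card * q := by
  constructor
  · rw [Finset.sum_congr rfl hr]; simp
  · rw [Finset.sum_congr rfl fun k hk => hr' k (Finset.mem_compl.mp hk)]; simp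

theorem class_margin_eq {ι : Type*} {r : ι → ℕ} {S : Finset ι} {R q : ℕ} (hr : ∀ k ∈ S, r k = R) (hr' : ∀ k ∉ S, r k = q) (k l : ι)
    (h : k ∈ S ↔ l ∈ S) : r k = r l := by
  by_cases hk : k ∈ S
  · rw [hr k hk, hr l (h.mp hk)]
  · rw [hr' k hk, hr' l fun hl => hk (h.mpr hl)]

/-- Raising t by one takes a unit from each mixed block and gives one to the normal block. The four
multiset ratios are stated without denominators; the two mixed ones agree, hence the square. -/
theorem card_blockFiber_succ (S : Finset ι) {W V t : ℕ} (hW : W ≤ V) (ht : t < W) :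
    ((blockFiber S S (t + 1) (W - (t + 1)) (W - (t + 1)) (V - (W - (t + 1)))).card : ℝ)
        * ((t + 1) * ((S.card * Sᶜ.card + ((W - t : ℕ) : ℝ) - 1) ^ 2 * ((V - (W - t) : ℕ) + 1)))
      = (blockFiber S S t (W - t) (W - t) (V - (W - t))).card
        * ((S.card ^ 2 + t) * ((W - t : ℕ) : ℝ) ^ 2 * (Sᶜ.card ^ 2 + (V - (W - t) : ℕ))) := by
  obtain ⟨u, hu⟩ : ∃ u, W - t = u + 1 := ⟨W - t - 1, by omega⟩
  have hu' : W - (t + 1) = u := by omega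
  obtain ⟨v, hv⟩ : ∃ v, V - (u + 1) = v := ⟨_, rfl⟩
  have hv' : V - u = v + 1 := by omega
  rw [hu', hu, hv, hv', card_blockFiber, card_blockFiber, mul_comm Sᶜ.card S.card]
  have h1 := multichoose_succ_mul (S.card * S.card) t
  have h2 := multichoose_succ_mul (S.card * Sᶜ.card) u
  have h3 := multichoose_succ_mul (Sᶜ.card * Sᶜ.card) v
  have h1' : ((S.card * S.card).multichoose (t + 1) : ℝ) * (t + 1)
      = (S.card * S.card).multichoose t * (S.card * S.card + t) := by exact_mod_cast h1
  have h2' : ((S.card * Sᶜ.card).multichoose (u + 1) : ℝ) * (u + 1)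
      = (S.card * Sᶜ.card).multichoose u * (S.card * Sᶜ.card + u) := by exact_mod_cast h2
  have h3' : ((Sᶜ.card * Sᶜ.card).multichoose (v + 1) : ℝ) * (v + 1)
      = (Sᶜ.card * Sᶜ.card).multichoose v * (Sᶜ.card * Sᶜ.card + v) := by exact_mod_cast h3
  push_cast
  calc _ = ((S.card * S.card).multichoose (t + 1) : ℝ) * (t + 1)
        * ((S.card * Sᶜ.card).multichoose u * (S.card * Sᶜ.card + u)) ^ 2
        * (((Sᶜ.card * Sᶜ.card).multichoose (v + 1) : ℝ) * (v + 1)) := by ring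
    _ = _ := by
      rw [h1', ← h2', h3']
      ring

theorem blockSum_le_of_mem_tables (hr : ∀ k ∈ S, r k = R) {A : ι → ι → ℕ} (hA : A ∈ tables r r) :
    blockSum A S S ≤ S.card * R := by
  have h := blockSum_add_compl A S S
  simp_rw [(mem_tables.mp hA).1] at h
  rw [Finset.sum_congr rfl hr] at h
  simp only [Finset.sum_const, smul_eq_mul] at h
  omega

/-- Bound the tables at t above by the block count, pass to t₁ by hypothesis, and return to tables
by balancing. Only this return costs the power of the total. -/
theorem tableCount_le_pow_mul (hr : ∀ k ∈ S, r k = R) (hr' : ∀ k ∉ S, r k = q)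
    (hW : S.card * R ≤ Sᶜ.card * q) {t t₁ : ℕ} (ht : t ≤ S.card * R) (ht₁ : t₁ ≤ S.card * R)
    {x : ℝ} (hx : 0 ≤ x)
    (h : ((blockFiber S S t (S.card * R - t) (S.card * R - t)
        (Sᶜ.card * q - (S.card * R - t))).card : ℝ)
      ≤ x * (blockFiber S S t₁ (S.card * R - t₁) (S.card * R - t₁)
        (Sᶜ.card * q - (S.card * R - t₁))).card) :
    (tableCount r r S S t : ℝ) ≤ x * ((S.card * R + Sᶜ.card * q + 1 : ℕ) : ℝ)
      ^ (2 * Fintype.card ι) * (tables r r).card := by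
  obtain ⟨h1, h2⟩ := sum_class_eq hr hr'
  have hcl := class_margin_eq hr hr'
  have h3 : tableCount r r S S t ≤ _ := tableCount_le_card_blockFiber
    (u := S.card * R - t) (u' := S.card * R - t) (v := Sᶜ.card * q - (S.card * R - t))
    (by omega) (by omega) (by omega)
  have h4 := card_blockFiber_le (t := t₁)
    (u := S.card * R - t₁) (u' := S.card * R - t₁) (v := Sᶜ.card * q - (S.card * R - t₁))
    hcl hcl (by omega) (by omega) (by omega) (by omega)
  rw [show t₁ + (S.card * R - t₁) + (S.card * R - t₁) + (Sᶜ.card * q - (S.card * R - t₁)) + 1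
    = S.card * R + Sᶜ.card * q + 1 by omega, ← two_mul] at h4
  have h5 : tableCount r r S S t₁ ≤ (tables r r).card := Finset.card_filter_le _ _
  have h6 := h4.trans (Nat.mul_le_mul_left _ h5)
  calc (tableCount r r S S t : ℝ) ≤ _ := by exact_mod_cast h3
    _ ≤ _ := h
    _ ≤ x * (((S.card * R + Sᶜ.card * q + 1 : ℕ) : ℝ) ^ (2 * Fintype.card ι)
        * (tables r r).card) := by
      gcongr
      exact_mod_cast h6
    _ = _ := by ring

theorem card_blockSum_mem_le (hr : ∀ k ∈ S, r k = R) (P : ℕ → Prop) [DecidablePred P] {x : ℝ}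
    (hx : 0 ≤ x) (h : ∀ t, t ≤ S.card * R → P t → (tableCount r r S S t : ℝ) ≤ x) :
    ({A ∈ tables r r | P (blockSum A S S)}.card : ℝ) ≤ (S.card * R + 1 : ℕ) * x := by
  rw [Finset.card_eq_sum_card_fiberwise (f := fun A => blockSum A S S)
    (t := Finset.range (S.card * R + 1))]
  · push_cast
    refine (Finset.sum_le_card_nsmul _ _ x fun t ht => ?_).trans (by simp)
    by_cases hP : P t
    · refine le_trans ?_ (h t (Nat.lt_succ_iff.mp (Finset.mem_range.mp ht)) hP)
      rw [tableCount]
      gcongr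
      exact Finset.filter_subset _ _
    · rw [Finset.card_eq_zero.mpr]
      · simpa using hx
      · rw [Finset.filter_eq_empty_iff]
        rintro A hA rfl
        exact hP (Finset.mem_filter.mp hA).2
  · intro A hA
    have := blockSum_le_of_mem_tables hr (Finset.mem_filter.mp hA).1
    simp only [Finset.coe_range, Set.mem_Iio]
    omega

/-- From t₁ on each step loses a factor κ, so every t ≥ t₂ has lost at least κ^(t₂ - t₁); then sum
over the possible t. -/
theorem card_le_blockSum_le (hr : ∀ k ∈ S, r k = R) (hr' : ∀ k ∉ S, r k = q)
    (hW : S.card * R ≤ Sᶜ.card * q) (hmn : 0 < S.card * Sᶜ.card) {κ : ℝ} (hκ0 : 0 ≤ κ)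
    (hκ1 : κ ≤ 1) {t₁ t₂ : ℕ} (h12 : t₁ ≤ t₂)
    (hκ : ∀ t, t₁ ≤ t → t < S.card * R →
      ((S.card ^ 2 + t) * ((S.card * R - t : ℕ) : ℝ) ^ 2
          * (Sᶜ.card ^ 2 + (Sᶜ.card * q - (S.card * R - t) : ℕ)))
        ≤ κ * ((t + 1) * ((S.card * Sᶜ.card + ((S.card * R - t : ℕ) : ℝ) - 1) ^ 2
          * ((Sᶜ.card * q - (S.card * R - t) : ℕ) + 1)))) :
    ({A ∈ tables r r | t₂ ≤ blockSum A S S}.card : ℝ)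
      ≤ (S.card * R + 1 : ℕ) * (κ ^ (t₂ - t₁) * ((S.card * R + Sᶜ.card * q + 1 : ℕ) : ℝ)
      ^ (2 * Fintype.card ι) * (tables r r).card) := by
  refine card_blockSum_mem_le hr (fun t => t₂ ≤ t) (by positivity) fun t ht htt => ?_
  have h := tableCount_le_pow_mul hr hr' hW ht (t₁ := t₁) (by omega) (pow_nonneg hκ0 (t - t₁))
    (le_pow_mul_of_ratio_le (F := fun t => ((blockFiber S S t (S.card * R - t) (S.card * R - t)
        (Sᶜ.card * q - (S.card * R - t))).card : ℝ)) (W := S.card * R) hκ0 ?_ (by omega) ht)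
  · refine h.trans ?_
    have : κ ^ (t - t₁) ≤ κ ^ (t₂ - t₁) := pow_le_pow_of_le_one hκ0 hκ1 (by omega)
    gcongr
  · intro t ht htW
    have hpos : 0 < ((t : ℝ) + 1) * ((S.card * Sᶜ.card + ((S.card * R - t : ℕ) : ℝ) - 1) ^ 2
          * ((Sᶜ.card * q - (S.card * R - t) : ℕ) + 1)) := by
      have h1 : (1 : ℝ) ≤ ((S.card * R - t : ℕ) : ℝ) := by
        exact_mod_cast (by omega : 1 ≤ S.card * R - t)
      have h2 : (0 : ℝ) < S.card * Sᶜ.card := by exact_mod_cast hmn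
      have h3 : 0 < S.card * Sᶜ.card + ((S.card * R - t : ℕ) : ℝ) - 1 := by linarith
      positivity
    refine le_of_mul_le_mul_right ?_ hpos
    rw [card_blockFiber_succ S hW htW]
    refine (mul_le_mul_of_nonneg_left (hκ t ht htW) (Nat.cast_nonneg _)).trans (le_of_eq ?_)
    ring

theorem card_blockSum_le_le (hr : ∀ k ∈ S, r k = R) (hr' : ∀ k ∉ S, r k = q)
    (hW : S.card * R ≤ Sᶜ.card * q) {κ : ℝ} (hκ0 : 0 ≤ κ)
    (hκ1 : κ ≤ 1) {t₁ t₂ : ℕ} (h12 : t₂ ≤ t₁) (ht₁ : t₁ ≤ S.card * R) (hm : 0 < S.card)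
    (hκ : ∀ t, t < t₁ →
      ((t + 1) * ((S.card * Sᶜ.card + ((S.card * R - t : ℕ) : ℝ) - 1) ^ 2
          * ((Sᶜ.card * q - (S.card * R - t) : ℕ) + 1)))
        ≤ κ * ((S.card ^ 2 + t) * ((S.card * R - t : ℕ) : ℝ) ^ 2
          * (Sᶜ.card ^ 2 + (Sᶜ.card * q - (S.card * R - t) : ℕ)))) (hn : 0 < Sᶜ.card) :
    ({A ∈ tables r r | blockSum A S S ≤ t₂}.card : ℝ)
      ≤ (S.card * R + 1 : ℕ) * (κ ^ (t₁ - t₂) * ((S.card * R + Sᶜ.card * q + 1 : ℕ) : ℝ)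
      ^ (2 * Fintype.card ι) * (tables r r).card) := by
  refine card_blockSum_mem_le hr (fun t => t ≤ t₂) (by positivity) fun t ht htt => ?_
  have h := tableCount_le_pow_mul hr hr' hW ht (t₁ := t₁) (by omega) (pow_nonneg hκ0 (t₁ - t))
    (le_pow_mul_of_le_ratio (F := fun t => ((blockFiber S S t (S.card * R - t) (S.card * R - t)
        (Sᶜ.card * q - (S.card * R - t))).card : ℝ)) hκ0 ?_ (by omega))
  · refine h.trans ?_
    have : κ ^ (t₁ - t) ≤ κ ^ (t₁ - t₂) := pow_le_pow_of_le_one hκ0 hκ1 (by omega)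
    gcongr
  · intro t ht
    have hpos : 0 < ((S.card : ℝ) ^ 2 + t) * ((S.card * R - t : ℕ) : ℝ) ^ 2
          * (Sᶜ.card ^ 2 + (Sᶜ.card * q - (S.card * R - t) : ℕ)) := by
      have h1 : (1 : ℝ) ≤ ((S.card * R - t : ℕ) : ℝ) := by
        exact_mod_cast (by omega : 1 ≤ S.card * R - t)
      have h2 : (0 : ℝ) < S.card := by exact_mod_cast hm
      have h3 : (0 : ℝ) < Sᶜ.card := by exact_mod_cast hn
      positivity
    refine le_of_mul_le_mul_right ?_ hpos
    rw [← card_blockFiber_succ S hW (by omega), mul_comm κ, mul_assoc]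
    exact mul_le_mul_of_nonneg_left (hκ t ht) (Nat.cast_nonneg _)

end TwoClass

/-! ### Asymptotics of the block-count ratios. -/

section Asymptotics

theorem one_le_bezel {n : ℕ} (hn : 1 ≤ n) {δ : ℝ} (hδ : 0 ≤ δ) : 1 ≤ bezel n δ := by
  rw [bezel, Nat.one_le_floor_iff]
  exact Real.one_le_rpow (by exact_mod_cast hn) hδ

theorem bezel_le_rpow (n : ℕ) (δ : ℝ) : (bezel n δ : ℝ) ≤ (n : ℝ) ^ δ :=
  Nat.floor_le (by positivity)

theorem bezel_le {n : ℕ} (hn : 1 ≤ n) {δ : ℝ} (hδ : δ ≤ 1) : bezel n δ ≤ n := by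
  have h : (bezel n δ : ℝ) ≤ n := by
    refine (bezel_le_rpow n δ).trans ?_
    calc (n : ℝ) ^ δ ≤ (n : ℝ) ^ (1 : ℝ) :=
          Real.rpow_le_rpow_of_exponent_le (by exact_mod_cast hn) hδ
      _ = n := Real.rpow_one _
  exact_mod_cast h

theorem rpow_le_two_mul_bezel {n : ℕ} (hn : 1 ≤ n) {δ : ℝ} (hδ : 0 ≤ δ) :
    (n : ℝ) ^ δ ≤ 2 * bezel n δ := by
  have h1 : (1 : ℝ) ≤ bezel n δ := by exact_mod_cast one_le_bezel hn hδ
  have h2 := (Nat.lt_floor_add_one ((n : ℝ) ^ δ)).le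
  rw [← bezel] at h2
  linarith

theorem tendsto_bezel_div {δ : ℝ} (hδ : δ < 1) :
    Tendsto (fun n : ℕ => (bezel n δ : ℝ) / n) atTop (𝓝 0) := by
  have h : Tendsto (fun n : ℕ => (n : ℝ) ^ (-(1 - δ))) atTop (𝓝 0) :=
    (tendsto_rpow_neg_atTop (by linarith)).comp tendsto_natCast_atTop_atTop
  refine squeeze_zero' (Eventually.of_forall fun n => by positivity) ?_ h
  filter_upwards [eventually_ge_atTop 1] with n hn
  have hn' : (0 : ℝ) < n := by exact_mod_cast hn
  rw [div_le_iff₀ hn', ← Real.rpow_add_one hn'.ne']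
  rw [show -(1 - δ) + 1 = δ by ring]
  exact bezel_le_rpow n δ

theorem tendsto_floor_mul_div {a : ℝ} (ha : 0 ≤ a) :
    Tendsto (fun n : ℕ => (⌊a * n⌋₊ : ℝ) / n) atTop (𝓝 a) :=
  (tendsto_nat_floor_mul_div_atTop ha).comp tendsto_natCast_atTop_atTop

theorem eventually_log_le_bezel {δ : ℝ} (hδ : 0 < δ) {c : ℝ} (hc : 0 < c) (K : ℝ) :
    ∀ᶠ n : ℕ in atTop, 17 * Real.log n + K ≤ c * bezel n δ := by
  have h1 := (isLittleO_log_rpow_atTop hδ).bound (c := c / 68) (by positivity)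
  have h2 : ∀ᶠ x : ℝ in atTop, 4 * K / c ≤ x ^ δ :=
    (tendsto_rpow_atTop hδ).eventually_ge_atTop _
  filter_upwards [tendsto_natCast_atTop_atTop.eventually h1,
    tendsto_natCast_atTop_atTop.eventually h2, eventually_ge_atTop 1] with n h1 h2 hn
  have hn' : (1 : ℝ) ≤ n := by exact_mod_cast hn
  rw [Real.norm_of_nonneg (Real.log_nonneg hn'), Real.norm_of_nonneg (by positivity)] at h1
  rw [div_le_iff₀ hc] at h2
  have h3 := mul_le_mul_of_nonneg_left (rpow_le_two_mul_bezel hn hδ.le) hc.le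
  nlinarith

/-- The two polynomial factors are at most n³ and n^(12n), and n² is wanted in the denominator: 12n
+ 5 ≤ 17n, whence the constant 17. The decay κ^k reaches exp(-17 n log n) because m outgrows log n.
-/
theorem eventually_bulk_le {B C δ : ℝ} (hB : 0 < B) (hC : 0 < C) (hδ : 0 < δ) (hδ1 : δ < 1)
    {κ η : ℝ} (hκ0 : 0 < κ) (hκ1 : κ < 1) (hη : 0 < η) :
    ∀ᶠ n : ℕ in atTop, ∀ k : ℕ, η * bezel n δ * n - 1 ≤ k →
      ((bezel n δ * ⌊B * C * n⌋₊ + 1 : ℕ) : ℝ) * (κ ^ k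
        * ((bezel n δ * ⌊B * C * n⌋₊ + n * ⌊C * n⌋₊ + 1 : ℕ) : ℝ) ^ (2 * (bezel n δ + n)))
      ≤ 1 / (n : ℝ) ^ 2 := by
  set l := - Real.log κ with hl
  have hl0 : 0 < l := by
    have := Real.log_neg hκ0 hκ1
    linarith
  -- The additive constant `l` absorbs the -1 in the lower bound for `k`.
  filter_upwards [eventually_log_le_bezel hδ (c := l * η) (by positivity) l,
    eventually_ge_atTop 1, eventually_ge_atTop (⌈B * C + C + 1⌉₊)] with n hlog hn hn3 k hk
  have hn' : (1 : ℝ) ≤ n := by exact_mod_cast hn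
  have hn0 : (0 : ℝ) < n := by linarith
  have hm : (bezel n δ : ℝ) ≤ n := by exact_mod_cast bezel_le hn hδ1.le
  have hR : (⌊B * C * n⌋₊ : ℝ) ≤ B * C * n := Nat.floor_le (by positivity)
  have hq : (⌊C * n⌋₊ : ℝ) ≤ C * n := Nat.floor_le (by positivity)
  have hn3' : B * C + C + 1 ≤ n := (Nat.le_ceil _).trans (by exact_mod_cast hn3)
  have hM : ((bezel n δ * ⌊B * C * n⌋₊ + n * ⌊C * n⌋₊ + 1 : ℕ) : ℝ) ≤ (n : ℝ) ^ 3 := by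
    push_cast
    calc (bezel n δ : ℝ) * ⌊B * C * n⌋₊ + n * ⌊C * n⌋₊ + 1
        ≤ n * (B * C * n) + n * (C * n) + (n : ℝ) ^ 2 := by
          gcongr
          exact one_le_pow₀ hn'
      _ = (B * C + C + 1) * (n : ℝ) ^ 2 := by ring
      _ ≤ n * (n : ℝ) ^ 2 := by gcongr
      _ = _ := by ring
  have hW : ((bezel n δ * ⌊B * C * n⌋₊ + 1 : ℕ) : ℝ) ≤ (n : ℝ) ^ 3 := by
    refine le_trans ?_ hM
    gcongr
    omega
  have hk' : κ ^ k ≤ Real.exp (-(17 * n * Real.log n)) := by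
    rw [← Real.exp_log hκ0, ← Real.exp_nat_mul]
    apply Real.exp_le_exp.mpr
    have h1 : l * (η * bezel n δ * n - 1) ≤ l * k := mul_le_mul_of_nonneg_left hk hl0.le
    have h2 := mul_le_mul_of_nonneg_right hlog hn0.le
    have h3 : Real.log κ = -l := by rw [hl]; ring
    rw [h3]
    nlinarith
  have hpow : (n : ℝ) ^ (17 * n) = Real.exp (17 * n * Real.log n) := by
    rw [← Real.rpow_natCast, Real.rpow_def_of_pos hn0]
    push_cast
    ring_nf
  calc _ ≤ (n : ℝ) ^ 3 * (Real.exp (-(17 * n * Real.log n)) * ((n : ℝ) ^ 3) ^ (2 * (n + n))) := by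
        have h2 : ((bezel n δ * ⌊B * C * n⌋₊ + n * ⌊C * n⌋₊ + 1 : ℕ) : ℝ) ^ (2 * (bezel n δ + n))
            ≤ ((n : ℝ) ^ 3) ^ (2 * (n + n)) := by
          refine (pow_le_pow_left₀ (Nat.cast_nonneg _) hM _).trans ?_
          apply pow_le_pow_right₀ (one_le_pow₀ hn')
          have := bezel_le hn hδ1.le
          omega
        gcongr
    _ = Real.exp (-(17 * n * Real.log n)) * (n : ℝ) ^ (12 * n + 3) := by ring
    _ ≤ 1 / (n : ℝ) ^ 2 := by
      rw [le_div_iff₀ (by positivity), mul_assoc, ← pow_add, Real.exp_neg, ← hpow,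
        inv_mul_le_iff₀ (by positivity), mul_one]
      exact pow_le_pow_right₀ hn' (by omega)

/-- The numerator is the least sum of the normal block, taken when the special block is empty. -/
theorem tendsto_min_normal {B C δ : ℝ} (hB : 0 < B) (hC : 0 < C) (hδ1 : δ < 1) :
    Tendsto (fun n : ℕ => ((n : ℝ) * ⌊C * n⌋₊ - bezel n δ * ⌊B * C * n⌋₊) / (n : ℝ) ^ 2)
      atTop (𝓝 C) := by
  have h := (tendsto_floor_mul_div hC.le).sub
    ((tendsto_bezel_div hδ1).mul (tendsto_floor_mul_div (a := B * C) (by positivity)))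
  rw [zero_mul, sub_zero] at h
  refine h.congr' ?_
  filter_upwards [eventually_ge_atTop 1] with n hn
  have hn0 : (n : ℝ) ≠ 0 := by positivity
  field_simp

theorem eventually_bezel_mul_le {B C δ : ℝ} (hB : 0 < B) (hC : 0 < C) (hδ1 : δ < 1) :
    ∀ᶠ n : ℕ in atTop, bezel n δ * ⌊B * C * n⌋₊ ≤ n * ⌊C * n⌋₊ := by
  filter_upwards [(tendsto_min_normal hB hC hδ1).eventually (lt_mem_nhds hC),
    eventually_ge_atTop 1] with n hn hn1
  have h := (div_pos_iff_of_pos_right (by positivity)).mp hn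
  have h2 : (bezel n δ : ℝ) * ⌊B * C * n⌋₊ ≤ n * ⌊C * n⌋₊ := by linarith
  exact_mod_cast h2

/-- Three factors: t ≥ σmn makes m² negligible against t; the mixed sum is at most βmn; the normal
sum is at least its minimum, about Cn². -/
theorem eventually_ratio_le {B C δ : ℝ} (hB : 0 < B) (hC : 0 < C) (hδ : 0 ≤ δ) (hδ1 : δ < 1)
    {κ β σ : ℝ} (hβ : 0 < β) (hσ : 0 < σ) (hβσ : B * C - σ ≤ β)
    (hκ : (β / (1 + β)) ^ 2 * (1 + 1 / C) < κ) :
    ∀ᶠ n : ℕ in atTop, ∀ t : ℕ, σ * bezel n δ * n ≤ t → t < bezel n δ * ⌊B * C * n⌋₊ →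
      (((bezel n δ : ℝ) ^ 2 + t) * ((bezel n δ * ⌊B * C * n⌋₊ - t : ℕ) : ℝ) ^ 2
          * ((n : ℝ) ^ 2 + (n * ⌊C * n⌋₊ - (bezel n δ * ⌊B * C * n⌋₊ - t) : ℕ)))
        ≤ κ * ((t + 1) * ((bezel n δ * n + ((bezel n δ * ⌊B * C * n⌋₊ - t : ℕ) : ℝ) - 1) ^ 2
          * ((n * ⌊C * n⌋₊ - (bezel n δ * ⌊B * C * n⌋₊ - t) : ℕ) + 1))) := by
  have hlim : Tendsto (fun n : ℕ => (1 + (bezel n δ : ℝ) / n / σ)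
      * (β / ((1 + β) * (1 - 1 / (n : ℝ)))) ^ 2
      * (1 + 1 / (((n : ℝ) * ⌊C * n⌋₊ - bezel n δ * ⌊B * C * n⌋₊) / (n : ℝ) ^ 2))) atTop
      (𝓝 ((1 + 0 / σ) * (β / ((1 + β) * (1 - 0))) ^ 2 * (1 + 1 / C))) := by
    refine Tendsto.mul (Tendsto.mul ?_ (Tendsto.pow ?_ 2)) ?_
    · exact tendsto_const_nhds.add ((tendsto_bezel_div hδ1).div_const σ)
    · refine Tendsto.div tendsto_const_nhds (Tendsto.mul tendsto_const_nhds
        (tendsto_const_nhds.sub tendsto_one_div_atTop_nhds_zero_nat)) ?_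
      simp only [sub_zero, mul_one]
      positivity
    · exact tendsto_const_nhds.add
        (Tendsto.div tendsto_const_nhds (tendsto_min_normal hB hC hδ1) hC.ne')
  rw [zero_div, add_zero, one_mul, sub_zero, mul_one] at hlim
  filter_upwards [hlim.eventually (gt_mem_nhds hκ), eventually_ge_atTop 2,
    (tendsto_min_normal hB hC hδ1).eventually (lt_mem_nhds hC),
    eventually_bezel_mul_le hB hC hδ1] with n hκn hn hvpos hWV t ht htW
  set m := bezel n δ with hm
  set R := ⌊B * C * n⌋₊ with hR
  set q := ⌊C * n⌋₊ with hq
  have hm1 : (1 : ℝ) ≤ m := by exact_mod_cast one_le_bezel (by omega) hδ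
  have hn2 : (2 : ℝ) ≤ n := by exact_mod_cast hn
  have hRle : (R : ℝ) ≤ B * C * n := Nat.floor_le (by positivity)
  have hu1 : (1 : ℝ) ≤ ((m * R - t : ℕ) : ℝ) := by exact_mod_cast (by omega : 1 ≤ m * R - t)
  have hucast : ((m * R - t : ℕ) : ℝ) = m * R - t := by
    rw [Nat.cast_sub htW.le]; push_cast; ring
  have hvcast : ((n * q - (m * R - t) : ℕ) : ℝ) = n * q - ((m * R - t : ℕ) : ℝ) := by
    rw [Nat.cast_sub (by omega)]; push_cast; ring
  rw [hvcast]
  set u : ℝ := ((m * R - t : ℕ) : ℝ) with hu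
  set v : ℝ := n * q - u with hv
  have ht0 : (0 : ℝ) ≤ t := Nat.cast_nonneg t
  have hub : u ≤ β * (m * n) := by
    have h1 : (m : ℝ) * R ≤ m * (B * C * n) := by gcongr
    have h2 : (B * C - σ) * (m * n) ≤ β * (m * n) := by gcongr
    linarith
  set e₁ := (m : ℝ) / n / σ
  set x := β / ((1 + β) * (1 - 1 / (n : ℝ)))
  have hvmin : 0 < (n : ℝ) * q - m * R := (div_pos_iff_of_pos_right (by positivity)).mp hvpos
  have hvge : (n : ℝ) * q - m * R ≤ v := by rw [hv, hucast]; linarith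
  have hv0 : 0 < v := hvmin.trans_le hvge
  have hn1 : 0 < 1 - 1 / (n : ℝ) := by
    rw [sub_pos, div_lt_one (by linarith)]
    linarith
  have h1 : (m : ℝ) ^ 2 + t ≤ (1 + e₁) * (t + 1) := by
    have : (m : ℝ) ^ 2 ≤ e₁ * t := by
      calc (m : ℝ) ^ 2 = e₁ * (σ * m * n) := by
            simp only [e₁]
            field_simp
        _ ≤ e₁ * t := by
          gcongr
    have h0 : 0 ≤ e₁ := by positivity
    linarith
  have hx0 : 0 ≤ x := by positivity
  have h2 : u ≤ x * (m * n + u - 1) := by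
    simp only [x]
    rw [div_mul_eq_mul_div, le_div_iff₀ (by positivity)]
    -- Since m ≥ 1, the factor 1 - 1/n pays for the -1.
    have h3 : (m * n + u) * (1 - 1 / (n : ℝ)) ≤ m * n + u - 1 := by
      have : (1 : ℝ) ≤ (m * n + u) * (1 / n) := by
        rw [mul_one_div, le_div_iff₀ (by linarith)]
        nlinarith
      linarith
    calc u * ((1 + β) * (1 - 1 / (n : ℝ))) = (u + β * u) * (1 - 1 / (n : ℝ)) := by ring
      _ ≤ (β * (m * n) + β * u) * (1 - 1 / (n : ℝ)) := by gcongr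
      _ = β * ((m * n + u) * (1 - 1 / (n : ℝ))) := by ring
      _ ≤ _ := by gcongr
  set e₂ := 1 / (((n : ℝ) * q - m * R) / (n : ℝ) ^ 2)
  have he₂ : 0 ≤ e₂ := by positivity
  have h3 : (n : ℝ) ^ 2 + v ≤ (1 + e₂) * (v + 1) := by
    have : (n : ℝ) ^ 2 ≤ e₂ * v := by
      calc (n : ℝ) ^ 2 = e₂ * ((n : ℝ) * q - m * R) := by
            simp only [e₂]
            field_simp
        _ ≤ e₂ * v := by gcongr
    linarith
  have hmnu : 0 ≤ (m : ℝ) * n + u - 1 := by nlinarith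
  calc _ ≤ ((1 + e₁) * (t + 1)) * (x * (m * n + u - 1)) ^ 2 * ((1 + e₂) * (v + 1)) := by gcongr
    _ = ((1 + e₁) * x ^ 2 * (1 + e₂)) * ((t + 1) * ((m * n + u - 1) ^ 2 * (v + 1))) := by ring
    _ ≤ _ := by gcongr

/-- The reverse estimates. Here t may be small, because t + 1 ≤ m² + t always; the mixed sum is at
least βmn and the normal sum at most n⌊Cn⌋. -/
theorem eventually_le_ratio {B C δ : ℝ} (hB : 0 < B) (hC : 0 < C) (hδ : 0 ≤ δ) (hδ1 : δ < 1)
    {κ β σ : ℝ} (hκ0 : 0 < κ) (hβ : 0 < β) (hβσ : β < B * C - σ)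
    (hκ : 1 < κ * ((β / (1 + β)) ^ 2 * (1 + 1 / C))) :
    ∀ᶠ n : ℕ in atTop, σ * bezel n δ * n ≤ bezel n δ * ⌊B * C * n⌋₊ ∧
      ∀ t : ℕ, t ≤ σ * bezel n δ * n → t < bezel n δ * ⌊B * C * n⌋₊ →
      (t + 1) * ((bezel n δ * n + ((bezel n δ * ⌊B * C * n⌋₊ - t : ℕ) : ℝ) - 1) ^ 2
          * ((n * ⌊C * n⌋₊ - (bezel n δ * ⌊B * C * n⌋₊ - t) : ℕ) + 1))
      ≤ κ * (((bezel n δ : ℝ) ^ 2 + t) * ((bezel n δ * ⌊B * C * n⌋₊ - t : ℕ) : ℝ) ^ 2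
          * ((n : ℝ) ^ 2 + (n * ⌊C * n⌋₊ - (bezel n δ * ⌊B * C * n⌋₊ - t) : ℕ))) := by
  have hlim : Tendsto (fun n : ℕ => κ * ((β / (1 + β)) ^ 2
      * (1 + (1 - 1 / (n : ℝ) * (1 / n)) / ((⌊C * n⌋₊ : ℝ) / n + 1 / n * (1 / n))))) atTop
      (𝓝 (κ * ((β / (1 + β)) ^ 2 * (1 + (1 - 0 * 0) / (C + 0 * 0))))) := by
    refine Tendsto.const_mul _ (Tendsto.const_mul _ (tendsto_const_nhds.add (Tendsto.div ?_ ?_ ?_)))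
    · exact tendsto_const_nhds.sub
        (tendsto_one_div_atTop_nhds_zero_nat.mul tendsto_one_div_atTop_nhds_zero_nat)
    · exact (tendsto_floor_mul_div hC.le).add
        (tendsto_one_div_atTop_nhds_zero_nat.mul tendsto_one_div_atTop_nhds_zero_nat)
    · simp only [mul_zero, add_zero]
      exact hC.ne'
  rw [mul_zero, sub_zero, add_zero] at hlim
  filter_upwards [hlim.eventually (lt_mem_nhds hκ), eventually_ge_atTop 2,
    (tendsto_floor_mul_div (a := B * C) (by positivity)).eventually
      (lt_mem_nhds (by linarith : β + σ < B * C)),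
    eventually_bezel_mul_le hB hC hδ1] with n hκn hn hRn hWV
  set m := bezel n δ with hm
  set R := ⌊B * C * n⌋₊ with hR
  set q := ⌊C * n⌋₊ with hq
  have hm1 : (1 : ℝ) ≤ m := by exact_mod_cast one_le_bezel (by omega) hδ
  have hn2 : (2 : ℝ) ≤ n := by exact_mod_cast hn
  rw [lt_div_iff₀ (by linarith)] at hRn
  refine ⟨?_, fun t ht htW => ?_⟩
  · have : σ * n ≤ R := by nlinarith
    nlinarith
  have hu1 : (1 : ℝ) ≤ ((m * R - t : ℕ) : ℝ) := by exact_mod_cast (by omega : 1 ≤ m * R - t)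
  have hucast : ((m * R - t : ℕ) : ℝ) = m * R - t := by
    rw [Nat.cast_sub htW.le]; push_cast; ring
  have hvle : ((n * q - (m * R - t) : ℕ) : ℝ) ≤ n * q := by
    exact_mod_cast Nat.sub_le _ _
  have hv0 : (0 : ℝ) ≤ ((n * q - (m * R - t) : ℕ) : ℝ) := Nat.cast_nonneg _
  set u : ℝ := ((m * R - t : ℕ) : ℝ) with hu
  set v : ℝ := ((n * q - (m * R - t) : ℕ) : ℝ) with hv
  have ht0 : (0 : ℝ) ≤ t := Nat.cast_nonneg t
  have hub : β * (m * n) ≤ u := by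
    have h1 : (m : ℝ) * ((β + σ) * n) ≤ m * R := by gcongr
    linarith
  set x := β / (1 + β)
  set e := (1 - 1 / (n : ℝ) * (1 / n)) / ((q : ℝ) / n + 1 / n * (1 / n)) with he
  have he' : e = ((n : ℝ) ^ 2 - 1) / (n * q + 1) := by
    rw [he]
    have : (n : ℝ) ≠ 0 := by linarith
    have h0 : (n : ℝ) * q + 1 ≠ 0 := by positivity
    field_simp
  have hn21 : 0 ≤ (n : ℝ) ^ 2 - 1 := by nlinarith
  have he0 : 0 ≤ e := by rw [he']; positivity
  have h1 : (t : ℝ) + 1 ≤ (m : ℝ) ^ 2 + t := by nlinarith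
  have h2 : x * (m * n + u - 1) ≤ u := by
    simp only [x]
    rw [div_mul_eq_mul_div, div_le_iff₀ (by positivity)]
    nlinarith
  have h3 : (1 + e) * (v + 1) ≤ (n : ℝ) ^ 2 + v := by
    have : e * (v + 1) ≤ (n : ℝ) ^ 2 - 1 := by
      calc e * (v + 1) ≤ e * (n * q + 1) := by gcongr
        _ = (n : ℝ) ^ 2 - 1 := by rw [he']; field_simp
    linarith
  have hmnu : 0 ≤ (m : ℝ) * n + u - 1 := by nlinarith
  have hx0 : 0 ≤ x := by positivity
  calc (t + 1) * ((m * n + u - 1) ^ 2 * (v + 1))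
      = 1 * ((t + 1) * ((m * n + u - 1) ^ 2 * (v + 1))) := by ring
    _ ≤ (κ * (x ^ 2 * (1 + e))) * ((t + 1) * ((m * n + u - 1) ^ 2 * (v + 1))) := by gcongr
    _ = κ * ((t + 1) * (x * (m * n + u - 1)) ^ 2 * ((1 + e) * (v + 1))) := by ring
    _ ≤ _ := by gcongr

/-- With s = √(1 + 1/C), the condition sβ/(1 + β) < 1 reads (s - 1)β < 1, and (s - 1)(1 + s)C = 1.
-/
theorem sq_ratio_lt_one {C β : ℝ} (hC : 0 < C) (hβ : 0 < β) (h : β < criticalValue C * C) :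
    (β / (1 + β)) ^ 2 * (1 + 1 / C) < 1 := by
  set s := Real.sqrt (1 + 1 / C) with hs
  have hs2 : s ^ 2 = 1 + 1 / C := Real.sq_sqrt (by positivity)
  have hs1 : 1 < s := by
    rw [hs, Real.lt_sqrt (by norm_num)]
    have : 0 < 1 / C := by positivity
    linarith
  have hc : criticalValue C = 1 + s := rfl
  rw [hc] at h
  have h1 : (s - 1) * ((1 + s) * C) = 1 := by
    have : (s - 1) * ((1 + s) * C) = (s ^ 2 - 1) * C := by ring
    rw [this, hs2]
    field_simp
    ring
  have h2 : β / (1 + β) * s < 1 := by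
    rw [div_mul_eq_mul_div, div_lt_one (by linarith)]
    nlinarith
  rw [← hs2, ← mul_pow]
  exact pow_lt_one₀ (by positivity) h2 (by norm_num)

theorem one_lt_sq_ratio {C β : ℝ} (hC : 0 < C) (h : criticalValue C * C < β) :
    1 < (β / (1 + β)) ^ 2 * (1 + 1 / C) := by
  set s := Real.sqrt (1 + 1 / C) with hs
  have hs2 : s ^ 2 = 1 + 1 / C := Real.sq_sqrt (by positivity)
  have hs1 : 1 < s := by
    rw [hs, Real.lt_sqrt (by norm_num)]
    have : 0 < 1 / C := by positivity
    linarith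
  have hc : criticalValue C = 1 + s := rfl
  rw [hc] at h
  have hβ : 0 < β := lt_trans (by positivity) h
  have h1 : (s - 1) * ((1 + s) * C) = 1 := by
    have : (s - 1) * ((1 + s) * C) = (s ^ 2 - 1) * C := by ring
    rw [this, hs2]
    field_simp
    ring
  have h2 : 1 < β / (1 + β) * s := by
    rw [div_mul_eq_mul_div, one_lt_div (by linarith)]
    nlinarith
  rw [← hs2, ← mul_pow]
  exact one_lt_pow₀ h2 (by norm_num)

end Asymptotics

/-! ### Rare events and Borel–Cantelli. -/

section Rare

/-- Membership in a filter, for an arbitrary decidability instance. -/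
theorem mem_filter_of_mem {α : Type*} {s : Finset α} {p : α → Prop} {hp : DecidablePred p} {a : α}
    (ha : a ∈ s) (hpa : p a) : a ∈ @Finset.filter α p hp s :=
  Finset.mem_filter.mpr ⟨ha, hpa⟩

/-- The indices of the first `⌊n ^ δ⌋` rows and columns. -/
noncomputable def specialIndices (n : ℕ) (δ : ℝ) : Finset (Fin (bezel n δ + n)) :=
  {i | (i : ℕ) < bezel n δ}

theorem mem_specialIndices {n : ℕ} {δ : ℝ} {i : Fin (bezel n δ + n)} :
    i ∈ specialIndices n δ ↔ (i : ℕ) < bezel n δ := by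
  simp [specialIndices]

theorem card_specialIndices (n : ℕ) (δ : ℝ) : (specialIndices n δ).card = bezel n δ := by
  rw [specialIndices, Fin.card_filter_val_lt]
  simp

theorem card_compl_specialIndices (n : ℕ) (δ : ℝ) : (specialIndices n δ)ᶜ.card = n := by
  rw [Finset.card_compl, card_specialIndices]
  simp

theorem blockMargin_special {n : ℕ} {δ B C : ℝ} :
    ∀ i ∈ specialIndices n δ, blockMargin n δ B C i = ⌊B * C * n⌋₊ := fun i hi => by
  rw [blockMargin, if_pos (mem_specialIndices.mp hi)]

theorem blockMargin_normal {n : ℕ} {δ B C : ℝ} :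
    ∀ i ∉ specialIndices n δ, blockMargin n δ B C i = ⌊C * n⌋₊ := fun i hi => by
  rw [blockMargin, if_neg fun h => hi (mem_specialIndices.mpr h)]

theorem blockTables_eq (n : ℕ) (δ B C : ℝ) :
    blockTables n δ B C = (tables (blockMargin n δ B C) (blockMargin n δ B C) : Set _) := by
  ext A
  rw [Finset.mem_coe, mem_tables]
  rfl

/-- The proportion of the events `E n` among the tables is at most of order `n⁻²`. -/
def Rare (B C δ : ℝ) (E : (n : ℕ) → Set (Table (bezel n δ + n) (bezel n δ + n))) : Prop :=
  ∃ K : ℝ, ∀ᶠ n : ℕ in atTop,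
    ((blockTables n δ B C ∩ E n).ncard : ℝ) ≤ K / (n : ℝ) ^ 2 * (blockTables n δ B C).ncard

variable {B C δ : ℝ} {E F : (n : ℕ) → Set (Table (bezel n δ + n) (bezel n δ + n))}

theorem finite_blockTables (n : ℕ) (δ B C : ℝ) : (blockTables n δ B C).Finite := by
  rw [blockTables_eq]
  exact Finset.finite_toSet _

theorem Rare.mono (hF : Rare B C δ F)
    (h : ∀ᶠ n : ℕ in atTop, ∀ A ∈ blockTables n δ B C, A ∈ E n → A ∈ F n) : Rare B C δ E := by
  obtain ⟨K, hK⟩ := hF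
  refine ⟨K, ?_⟩
  filter_upwards [hK, h] with n hK h
  refine le_trans ?_ hK
  have hsub : blockTables n δ B C ∩ E n ⊆ blockTables n δ B C ∩ F n :=
    fun A hA => ⟨hA.1, h A hA.1 hA.2⟩
  exact_mod_cast Set.ncard_le_ncard hsub ((finite_blockTables n δ B C).inter_of_left _)

theorem Rare.union (hE : Rare B C δ E) (hF : Rare B C δ F) : Rare B C δ fun n => E n ∪ F n := by
  obtain ⟨K, hK⟩ := hE
  obtain ⟨L, hL⟩ := hF
  refine ⟨K + L, ?_⟩
  filter_upwards [hK, hL] with n hK hL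
  rw [Set.inter_union_distrib_left, add_div, add_mul]
  refine le_trans ?_ (add_le_add hK hL)
  exact_mod_cast Set.ncard_union_le _ _

theorem Rare.of_card_le (K : ℝ)
    (p : (n : ℕ) → Table (bezel n δ + n) (bezel n δ + n) → Prop)
    (h : ∀ᶠ n : ℕ in atTop, ∃ s : Finset (Table (bezel n δ + n) (bezel n δ + n)),
      (∀ A ∈ tables (blockMargin n δ B C) (blockMargin n δ B C), p n A → A ∈ s) ∧
      (s.card : ℝ)
        ≤ K / (n : ℝ) ^ 2 * (tables (blockMargin n δ B C) (blockMargin n δ B C)).card) :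
    Rare B C δ fun n => {A | p n A} := by
  refine ⟨K, ?_⟩
  filter_upwards [h] with n ⟨s, hs, h⟩
  rw [blockTables_eq, Set.ncard_coe_finset]
  refine le_trans ?_ h
  have hsub : (tables (blockMargin n δ B C) (blockMargin n δ B C) : Set _) ∩ {A | p n A} ⊆ s :=
    fun A hA => hs A hA.1 hA.2
  rw [← Set.ncard_coe_finset s]
  exact_mod_cast Set.ncard_le_ncard hsub s.finite_toSet

theorem Rare.ae_eventually_notMem {Ω : Type*} [MeasurableSpace Ω] {P : Measure Ω}
    {X : (n : ℕ) → Ω → Table (bezel n δ + n) (bezel n δ + n)}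
    (hX : ∀ n : ℕ, 1 ≤ n → HasLaw (X n) (uniformOn (blockTables n δ B C)) P)
    (hE : Rare B C δ E) : ∀ᵐ ω ∂P, ∀ᶠ n : ℕ in atTop, X n ω ∉ E n := by
  obtain ⟨K, hK⟩ := hE
  obtain ⟨n₀, hn₀⟩ := eventually_atTop.mp hK
  -- The condition `max n₀ 1 ≤ n` discards the finitely many indices at which the law or the bound
  -- is not available.
  have hsum : ∑' n : ℕ, P {ω | max n₀ 1 ≤ n ∧ X n ω ∈ E n} ≠ ⊤ := by
    have hs : Summable fun n : ℕ => K / (n : ℝ) ^ 2 := by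
      have h := (Real.summable_one_div_nat_pow.mpr (by norm_num : 1 < 2)).mul_left K
      refine h.congr fun n => ?_
      ring
    refine ne_top_of_le_ne_top hs.tsum_ofReal_ne_top (ENNReal.tsum_le_tsum fun n => ?_)
    by_cases hn : max n₀ 1 ≤ n
    · have hmeas : ∀ s : Set (Table (bezel n δ + n) (bezel n δ + n)), MeasurableSet s := fun s =>
        s.to_countable.measurableSet
      have hlaw := hX n ((le_max_right _ _).trans hn)
      have h1 : P {ω | max n₀ 1 ≤ n ∧ X n ω ∈ E n} = uniformOn (blockTables n δ B C) (E n) := by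
        rw [← hlaw.map_eq, Measure.map_apply_of_aemeasurable hlaw.aemeasurable (hmeas _)]
        simp [hn, Set.preimage]
      have h2 := hn₀ n ((le_max_left _ _).trans hn)
      have hfin := finite_blockTables n δ B C
      rw [h1, uniformOn, cond_apply (hmeas _), Measure.count_apply (hmeas _),
        Measure.count_apply (hmeas _), ← hfin.cast_ncard_eq,
        ← (hfin.inter_of_left (E n)).cast_ncard_eq]
      simp only [ENat.toENNReal_coe]
      rcases Nat.eq_zero_or_pos (blockTables n δ B C).ncard with h0 | h0
      · have h3 : (blockTables n δ B C ∩ E n).ncard = 0 :=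
          Nat.le_zero.mp ((Set.ncard_le_ncard Set.inter_subset_left hfin).trans h0.le)
        simp [h3]
      · rw [← ENNReal.ofReal_natCast, ← ENNReal.ofReal_natCast,
          ← ENNReal.ofReal_inv_of_pos (by exact_mod_cast h0), ← ENNReal.ofReal_mul (by positivity)]
        apply ENNReal.ofReal_le_ofReal
        rw [inv_mul_le_iff₀ (by exact_mod_cast h0), mul_comm]
        exact h2
    · simp [hn]
  filter_upwards [MeasureTheory.ae_eventually_notMem hsum] with ω hω
  filter_upwards [hω, eventually_ge_atTop (max n₀ 1)] with n h1 h2 h3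
  exact h1 ⟨h2, h3⟩

theorem ae_tendsto_of_rare {Ω : Type*} [MeasurableSpace Ω] {P : Measure Ω}
    {X : (n : ℕ) → Ω → Table (bezel n δ + n) (bezel n δ + n)}
    (hX : ∀ n : ℕ, 1 ≤ n → HasLaw (X n) (uniformOn (blockTables n δ B C)) P)
    (f : (n : ℕ) → Table (bezel n δ + n) (bezel n δ + n) → ℝ) (l : ℝ)
    (h : ∀ ε : ℝ, 0 < ε → Rare B C δ fun n => {A | ε ≤ |f n A - l|}) :
    ∀ᵐ ω ∂P, Tendsto (fun n => f n (X n ω)) atTop (𝓝 l) := by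
  have h1 : ∀ᵐ ω ∂P, ∀ k : ℕ, ∀ᶠ n : ℕ in atTop,
      X n ω ∉ {A | 1 / ((k : ℝ) + 1) ≤ |f n A - l|} :=
    ae_all_iff.mpr fun k => (h (1 / ((k : ℝ) + 1)) (by positivity)).ae_eventually_notMem hX
  filter_upwards [h1] with ω hω
  rw [Metric.tendsto_nhds]
  intro ε hε
  obtain ⟨k, hk⟩ := exists_nat_one_div_lt hε
  filter_upwards [hω k] with n hn
  simp only [not_le] at hn
  rw [Real.dist_eq]
  exact hn.trans hk

end Rare

/-! ### Concentration of the special block sum. -/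

section Bulk

variable {B C δ : ℝ}

/-- Once t ≥ σmn the ratio of consecutive counts is below some κ < 1, and there are at least ηmn - 1
further steps up to (σ + η)mn. -/
theorem rare_bulk_ge (hB : 0 < B) (hC : 0 < C) (hδ : 0 < δ) (hδ1 : δ < 1) {β σ η : ℝ}
    (hβ : 0 < β) (hσ : 0 < σ) (hη : 0 < η) (hβσ : B * C - σ ≤ β)
    (hκ : (β / (1 + β)) ^ 2 * (1 + 1 / C) < 1) :
    Rare B C δ fun n => {A | (σ + η) * bezel n δ * n
      ≤ (blockSum A (specialIndices n δ) (specialIndices n δ) : ℝ)} := by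
  obtain ⟨κ, hκ1, hκ2⟩ := exists_between hκ
  have hκ0 : 0 < κ := lt_trans (by positivity) hκ1
  apply Rare.of_card_le 1
  filter_upwards [eventually_ratio_le hB hC hδ.le hδ1 hβ hσ hβσ hκ1,
    eventually_bulk_le hB hC hδ hδ1 hκ0 hκ2 hη, eventually_bezel_mul_le hB hC hδ1,
    eventually_ge_atTop 1] with n hr hb hW hn
  have hm := one_le_bezel hn hδ.le
  have h := card_le_blockSum_le (S := specialIndices n δ) (r := blockMargin n δ B C)
    blockMargin_special blockMargin_normal
    (by rw [card_specialIndices, card_compl_specialIndices]; exact hW)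
    (by rw [card_specialIndices, card_compl_specialIndices]; positivity) hκ0.le hκ2.le
    (t₁ := ⌈σ * bezel n δ * n⌉₊) (t₂ := ⌈(σ + η) * bezel n δ * n⌉₊)
    (Nat.ceil_mono (by gcongr; linarith)) ?_
  · rw [card_specialIndices, card_compl_specialIndices, Fintype.card_fin] at h
    have h2 := hb (⌈(σ + η) * bezel n δ * n⌉₊ - ⌈σ * bezel n δ * n⌉₊) ?_
    · refine ⟨_, fun A hA hA' => Finset.mem_filter.mpr ⟨hA, Nat.ceil_le.mpr hA'⟩, h.trans ?_⟩
      rw [← mul_assoc]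
      exact mul_le_mul_of_nonneg_right h2 (Nat.cast_nonneg _)
    · have h3 := Nat.le_ceil ((σ + η) * bezel n δ * n)
      have h4 := (Nat.ceil_lt_add_one (by positivity : 0 ≤ σ * bezel n δ * n)).le
      rw [Nat.cast_sub (Nat.ceil_mono (by gcongr; linarith))]
      linarith
  · intro t ht htW
    rw [card_specialIndices] at htW ⊢
    rw [card_compl_specialIndices]
    exact hr t (Nat.ceil_le.mp ht) htW

theorem rare_bulk_le (hB : 0 < B) (hC : 0 < C) (hδ : 0 < δ) (hδ1 : δ < 1) {β σ η : ℝ}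
    (hβ : 0 < β) (hη : 0 < η) (hησ : η < σ) (hβσ : β < B * C - σ)
    (hκ : 1 < (β / (1 + β)) ^ 2 * (1 + 1 / C)) :
    Rare B C δ fun n => {A | (blockSum A (specialIndices n δ) (specialIndices n δ) : ℝ)
      ≤ (σ - η) * bezel n δ * n} := by
  have hσ : 0 < σ := hη.trans hησ
  obtain ⟨κ, hκ1, hκ2⟩ := exists_between (inv_lt_one_of_one_lt₀ hκ)
  have hκ0 : 0 < κ := lt_trans (by positivity) hκ1
  have hκ' : 1 < κ * ((β / (1 + β)) ^ 2 * (1 + 1 / C)) := by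
    rw [inv_lt_iff_one_lt_mul₀ (by positivity)] at hκ1
    linarith
  apply Rare.of_card_le 1
  filter_upwards [eventually_le_ratio hB hC hδ.le hδ1 hκ0 hβ hβσ hκ',
    eventually_bulk_le hB hC hδ hδ1 hκ0 hκ2 hη, eventually_bezel_mul_le hB hC hδ1,
    eventually_ge_atTop 1] with n hr hb hW hn
  have hm := one_le_bezel hn hδ.le
  have hpos : 0 ≤ (σ - η) * bezel n δ * n := by
    have : 0 < σ - η := by linarith
    positivity
  have hmono : ⌊(σ - η) * bezel n δ * n⌋₊ ≤ ⌊σ * bezel n δ * n⌋₊ :=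
    Nat.floor_mono (by gcongr; linarith)
  have ht₁ : ⌊σ * bezel n δ * n⌋₊ ≤ bezel n δ * ⌊B * C * n⌋₊ := by
    apply Nat.floor_le_of_le
    exact_mod_cast hr.1
  have h := card_blockSum_le_le (S := specialIndices n δ) (r := blockMargin n δ B C)
    blockMargin_special blockMargin_normal
    (by rw [card_specialIndices, card_compl_specialIndices]; exact hW)
    hκ0.le hκ2.le
    (t₁ := ⌊σ * bezel n δ * n⌋₊) (t₂ := ⌊(σ - η) * bezel n δ * n⌋₊) hmono
    (by rw [card_specialIndices]; exact ht₁) (by rw [card_specialIndices]; omega) ?_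
    (by rw [card_compl_specialIndices]; omega)
  · rw [card_specialIndices, card_compl_specialIndices, Fintype.card_fin] at h
    have h2 := hb (⌊σ * bezel n δ * n⌋₊ - ⌊(σ - η) * bezel n δ * n⌋₊) ?_
    · refine ⟨_, fun A hA hA' => Finset.mem_filter.mpr ⟨hA, Nat.le_floor hA'⟩, h.trans ?_⟩
      rw [← mul_assoc]
      exact mul_le_mul_of_nonneg_right h2 (Nat.cast_nonneg _)
    · have h3 := Nat.floor_le hpos
      have h4 := (Nat.lt_floor_add_one (σ * bezel n δ * n)).le
      rw [Nat.cast_sub hmono]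
      linarith
  · intro t ht
    rw [card_specialIndices, card_compl_specialIndices]
    exact hr.2 t ((Nat.le_floor_iff (by positivity)).mp ht.le) (ht.trans_le ht₁)

end Bulk

/-! ### Large entries and row deviations are rare. -/

section Entries

variable {B C δ : ℝ}

/-- The moment p is chosen so that the tail is O(n⁻⁴), leaving n⁻² after a union over at most n²
entries. -/
theorem eventually_moment_bound {a K : ℝ} (hK : 0 ≤ K) {p : ℕ} (hp : 4 ≤ a * p) {n : ℕ}
    (hn : 1 ≤ n) {x y : ℝ} (hx0 : 0 ≤ x) (hx : x ≤ K * (n : ℝ) ^ (-a)) (hy : y ≤ (n : ℝ) ^ 2)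
    (hy0 : 0 ≤ y) : x ^ p * y ≤ K ^ p / (n : ℝ) ^ 2 := by
  have hn' : (1 : ℝ) ≤ n := by exact_mod_cast hn
  have hn0 : (0 : ℝ) < n := by linarith
  have h1 : ((n : ℝ) ^ (-a)) ^ p ≤ ((n : ℝ) ^ 4)⁻¹ := by
    rw [← Real.rpow_natCast, ← Real.rpow_mul hn0.le, ← Real.rpow_natCast (n := 4),
      ← Real.rpow_neg hn0.le]
    apply Real.rpow_le_rpow_of_exponent_le hn'
    push_cast
    linarith
  calc x ^ p * y ≤ (K * (n : ℝ) ^ (-a)) ^ p * (n : ℝ) ^ 2 := by gcongr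
    _ = K ^ p * ((n : ℝ) ^ (-a)) ^ p * (n : ℝ) ^ 2 := by rw [mul_pow]
    _ ≤ K ^ p * ((n : ℝ) ^ 4)⁻¹ * (n : ℝ) ^ 2 := by gcongr
    _ = _ := by field_simp

/-- A margin of order n spread over m rows gives entries of scale n^(1-δ), which the threshold
exceeds by n^(δ/2). -/
theorem rare_large_special_entry (hB : 0 < B) (hC : 0 < C) (hδ : 0 < δ) (hδ1 : δ < 1) :
    Rare B C δ fun n => {A | ∃ i ∈ specialIndices n δ, ∃ j ∈ specialIndices n δ,
      (n : ℝ) ^ (1 - δ / 2) ≤ A i j} := by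
  obtain ⟨p, hp⟩ := exists_nat_ge (4 / (δ / 2))
  have hp' : 4 ≤ δ / 2 * p := by
    rwa [div_le_iff₀ (by positivity), mul_comm] at hp
  apply Rare.of_card_le ((12 * 2 ^ p * (4 * (B * C) + 1)) ^ p)
  have hm2 : ∀ᶠ n : ℕ in atTop, (2 : ℝ) ≤ bezel n δ := by
    have h : ∀ᶠ x : ℝ in atTop, (4 : ℝ) ≤ x ^ δ := (tendsto_rpow_atTop hδ).eventually_ge_atTop _
    filter_upwards [tendsto_natCast_atTop_atTop.eventually h, eventually_ge_atTop 1] with n h hn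
    linarith [rpow_le_two_mul_bezel hn hδ.le]
  filter_upwards [hm2, eventually_ge_atTop 1] with n hm2 hn
  have hn' : (1 : ℝ) ≤ n := by exact_mod_cast hn
  have hn0 : (0 : ℝ) < n := by linarith
  have h := card_tables_large_entry_le (G := specialIndices n δ) (r := blockMargin n δ B C)
    (c := blockMargin n δ B C) (by rw [card_specialIndices]; exact_mod_cast hm2)
    blockMargin_special (specialIndices n δ) blockMargin_special p
    (L := (n : ℝ) ^ (1 - δ / 2)) (by positivity)
  refine ⟨_, fun A hA hA' => mem_filter_of_mem hA hA', h.trans ?_⟩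
  rw [card_specialIndices, ← mul_assoc]
  gcongr
  have hm1 : (0 : ℝ) < bezel n δ - 1 := by linarith
  have hmn : (bezel n δ : ℝ) ≤ n := by exact_mod_cast bezel_le hn hδ1.le
  apply eventually_moment_bound (by positivity) hp' hn
  · positivity
  · rw [div_le_iff₀ (by positivity), mul_assoc (12 * 2 ^ p * (4 * (B * C) + 1)),
      ← Real.rpow_add hn0,
      show -(δ / 2) + (1 - δ / 2) = 1 - δ by ring, mul_assoc (12 * 2 ^ p : ℝ)]
    have h1 : (1 : ℝ) ≤ (n : ℝ) ^ (1 - δ) := Real.one_le_rpow hn' (by linarith)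
    have h2 : (⌊B * C * n⌋₊ : ℝ) / (bezel n δ - 1) ≤ 4 * (B * C) * (n : ℝ) ^ (1 - δ) := by
      rw [div_le_iff₀ hm1]
      have h3 : (⌊B * C * n⌋₊ : ℝ) ≤ B * C * n := Nat.floor_le (by positivity)
      have h4 : (n : ℝ) = (n : ℝ) ^ (1 - δ) * (n : ℝ) ^ δ := by
        rw [← Real.rpow_add hn0]; simp
      have h5 := rpow_le_two_mul_bezel hn hδ.le
      calc (⌊B * C * n⌋₊ : ℝ) ≤ B * C * ((n : ℝ) ^ (1 - δ) * (n : ℝ) ^ δ) := by rwa [← h4]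
        _ ≤ B * C * ((n : ℝ) ^ (1 - δ) * (4 * (bezel n δ - 1))) := by
          gcongr
          linarith
        _ = _ := by ring
    gcongr
    linarith
  · rw [sq]
    gcongr
  · positivity

/-- A special column spreads its margin over n normal rows, so these entries have bounded moments,
while the threshold is at least εn^(1-δ). -/
theorem rare_large_mixed_entry (hB : 0 < B) (hC : 0 < C) (hδ : 0 ≤ δ) (hδ1 : δ < 1) {ε : ℝ}
    (hε : 0 < ε) :
    Rare B C δ fun n => {A | ∃ i ∈ (specialIndices n δ)ᶜ, ∃ j ∈ specialIndices n δ,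
      ε * n / bezel n δ ≤ A i j} := by
  obtain ⟨p, hp⟩ := exists_nat_ge (4 / (1 - δ))
  have hp' : 4 ≤ (1 - δ) * p := by
    rwa [div_le_iff₀ (by linarith), mul_comm] at hp
  apply Rare.of_card_le ((12 * 2 ^ p * (2 * (B * C) + 1) / ε) ^ p)
  filter_upwards [eventually_ge_atTop 2] with n hn
  have hn' : (2 : ℝ) ≤ n := by exact_mod_cast hn
  have hn0 : (0 : ℝ) < n := by linarith
  have hm0 : (0 : ℝ) < bezel n δ := by exact_mod_cast one_le_bezel (by omega) hδ
  have h := card_tables_large_entry_le (G := (specialIndices n δ)ᶜ) (r := blockMargin n δ B C)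
    (c := blockMargin n δ B C) (by rw [card_compl_specialIndices]; exact hn)
    (fun i hi => blockMargin_normal i (Finset.mem_compl.mp hi))
    (specialIndices n δ) blockMargin_special p
    (L := ε * n / bezel n δ) (by positivity)
  refine ⟨_, fun A hA hA' => mem_filter_of_mem hA hA', h.trans ?_⟩
  rw [card_compl_specialIndices, card_specialIndices, ← mul_assoc]
  gcongr
  have hn1 : (0 : ℝ) < (n : ℝ) - 1 := by linarith
  have hmn : (bezel n δ : ℝ) ≤ n := by exact_mod_cast bezel_le (by omega) hδ1.le
  apply eventually_moment_bound (by positivity) hp' (by omega)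
  · positivity
  · rw [div_le_iff₀ (by positivity)]
    have h2 : (⌊B * C * n⌋₊ : ℝ) / (n - 1) ≤ 2 * (B * C) := by
      rw [div_le_iff₀ hn1]
      have h3 : (⌊B * C * n⌋₊ : ℝ) ≤ B * C * n := Nat.floor_le (by positivity)
      have : 0 < B * C := by positivity
      nlinarith
    have h3 : 1 ≤ (n : ℝ) ^ (-(1 - δ)) * (n / bezel n δ) := by
      rw [mul_div_assoc', ← Real.rpow_add_one hn0.ne', show -(1 - δ) + 1 = δ by ring,
        one_le_div hm0]
      exact bezel_le_rpow n δ
    calc 12 * 2 ^ p * ((⌊B * C * n⌋₊ : ℝ) / (n - 1) + 1)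
        ≤ 12 * 2 ^ p * (2 * (B * C) + 1) * 1 := by
          rw [mul_one]
          gcongr
      _ ≤ 12 * 2 ^ p * (2 * (B * C) + 1) * ((n : ℝ) ^ (-(1 - δ)) * (n / bezel n δ)) := by gcongr
      _ = _ := by field_simp
  · rw [sq]
    gcongr
  · positivity

/-- With entries below n^(1-δ/2), the Hoeffding exponent has order at least n^(δ/2) and beats log n.
Row 1 is named by an existential because the index type is empty at n = 0. -/
theorem rare_row_deviation (hB : 0 < B) (hC : 0 < C) (hδ : 0 < δ) (hδ1 : δ < 1) {ε : ℝ}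
    (hε : 0 < ε) :
    Rare B C δ fun n => {A | ∃ i₀ : Fin (bezel n δ + n), (i₀ : ℕ) = 0 ∧
      (∃ i ∈ specialIndices n δ, ε * n ≤ |∑ j ∈ specialIndices n δ, (A i₀ j : ℝ)
        - ∑ j ∈ specialIndices n δ, (A i j : ℝ)|) ∧
      ∀ i ∈ specialIndices n δ, ∀ j ∈ specialIndices n δ, (A i j : ℝ) < (n : ℝ) ^ (1 - δ / 2)} := by
  apply Rare.of_card_le (2 * (2 * (B * C) + 1))
  set c := ε ^ 2 / (8 * (B * C)) with hc
  have hc0 : 0 < c := by positivity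
  have hlog := (isLittleO_log_rpow_atTop (by positivity : 0 < δ / 2)).bound
    (c := c / 4) (by positivity)
  filter_upwards [tendsto_natCast_atTop_atTop.eventually hlog, eventually_ge_atTop 1,
    (tendsto_floor_mul_div (a := B * C) (by positivity)).eventually
      (lt_mem_nhds (by positivity : 0 < B * C))] with n hlog hn hRpos
  have hn' : (1 : ℝ) ≤ n := by exact_mod_cast hn
  have hn0 : (0 : ℝ) < n := by linarith
  have hm := one_le_bezel hn hδ.le
  have hR0 : (0 : ℝ) < ⌊B * C * n⌋₊ := (div_pos_iff_of_pos_right hn0).mp hRpos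
  have hRle : (⌊B * C * n⌋₊ : ℝ) ≤ B * C * n := Nat.floor_le (by positivity)
  rw [Real.norm_of_nonneg (Real.log_nonneg hn'), Real.norm_of_nonneg (by positivity)] at hlog
  have h := card_tables_row_deviation_le (G := specialIndices n δ) (r := blockMargin n δ B C)
    (c := blockMargin n δ B C) blockMargin_special (i₀ := ⟨0, by omega⟩)
    (mem_specialIndices.mpr hm) (specialIndices n δ)
    (L := (n : ℝ) ^ (1 - δ / 2)) (τ := ε * n) (by positivity) (by exact_mod_cast hR0)
    (by positivity)
  refine ⟨_, fun A hA ⟨i₀, hi₀, h1⟩ => ?_, h.trans ?_⟩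
  · refine mem_filter_of_mem hA ?_
    have hi : i₀ = ⟨0, by omega⟩ := Fin.ext hi₀
    rwa [hi] at h1
  · rw [card_specialIndices, ← mul_assoc]
    gcongr
    have hexp : Real.exp (-((ε * n) ^ 2 / (8 * (n : ℝ) ^ (1 - δ / 2) * ⌊B * C * n⌋₊)))
        ≤ ((n : ℝ) ^ 4)⁻¹ := by
      rw [Real.exp_neg]
      gcongr
      have h1 : (n : ℝ) ^ 4 = Real.exp (4 * Real.log n) := by
        rw [← Real.rpow_natCast, Real.rpow_def_of_pos hn0]
        push_cast
        ring_nf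
      rw [h1]
      apply Real.exp_le_exp.mpr
      calc 4 * Real.log n ≤ c * (n : ℝ) ^ (δ / 2) := by linarith
        _ ≤ _ := by
          rw [le_div_iff₀ (by positivity)]
          calc c * (n : ℝ) ^ (δ / 2) * (8 * (n : ℝ) ^ (1 - δ / 2) * ⌊B * C * n⌋₊)
              ≤ c * (n : ℝ) ^ (δ / 2) * (8 * (n : ℝ) ^ (1 - δ / 2) * (B * C * n)) := by gcongr
            _ = c * (8 * (B * C)) * ((n : ℝ) ^ (δ / 2) * (n : ℝ) ^ (1 - δ / 2)) * n := by ring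
            _ = (ε * n) ^ 2 := by
              rw [← Real.rpow_add hn0, show δ / 2 + (1 - δ / 2) = 1 by ring, Real.rpow_one, hc]
              field_simp
    have hmn : (bezel n δ : ℝ) ≤ n := by exact_mod_cast bezel_le hn hδ1.le
    calc (bezel n δ : ℝ) * (2 * Real.exp (-((ε * n) ^ 2
          / (8 * (n : ℝ) ^ (1 - δ / 2) * ⌊B * C * n⌋₊))) * (2 * ⌊B * C * n⌋₊ + 1))
        ≤ n * (2 * ((n : ℝ) ^ 4)⁻¹ * (2 * (B * C * n) + n)) := by gcongr
      _ = _ := by field_simp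

end Entries

/-! ### The two limits. -/

section Main

variable {B C δ : ℝ}

theorem sum_entry_eq {n : ℕ} (A : Table (bezel n δ + n) (bezel n δ + n))
    (i : Fin (bezel n δ + n)) :
    ∑ k ∈ Finset.Icc 1 n, (entry A (i + 1) (k + bezel n δ) : ℝ)
      = ∑ j ∈ (specialIndices n δ)ᶜ, (A i j : ℝ) := by
  symm
  refine Finset.sum_nbij (fun j => (j : ℕ) + 1 - bezel n δ) ?_ ?_ ?_ ?_
  · intro j hj
    rw [Finset.mem_compl, mem_specialIndices] at hj
    rw [Finset.mem_Icc]
    have := j.isLt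
    omega
  · intro j hj k hk hjk
    rw [Finset.mem_coe, Finset.mem_compl, mem_specialIndices] at hj hk
    simp only at hjk
    ext
    omega
  · intro k hk
    rw [Finset.mem_coe, Finset.mem_Icc] at hk
    refine ⟨⟨k + bezel n δ - 1, by omega⟩, ?_, ?_⟩
    · rw [Finset.mem_coe, Finset.mem_compl, mem_specialIndices]
      simp only
      omega
    · simp only
      omega
  · intro j hj
    rw [Finset.mem_compl, mem_specialIndices] at hj
    have hi := i.isLt
    have hj' := j.isLt
    rw [entry, dif_pos (by omega)]
    congr 2
    ext
    simp only
    omega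

theorem sum_entry_eq_sub {n : ℕ} {A : Table (bezel n δ + n) (bezel n δ + n)}
    (hA : A ∈ blockTables n δ B C) (i : Fin (bezel n δ + n)) :
    ∑ k ∈ Finset.Icc 1 n, (entry A (i + 1) (k + bezel n δ) : ℝ)
      = blockMargin n δ B C i - ∑ j ∈ specialIndices n δ, (A i j : ℝ) := by
  rw [sum_entry_eq, ← hA.1 i, eq_sub_iff_add_eq, Finset.sum_compl_add_sum]
  push_cast
  rfl

/-- Averaging the row deviations over the special rows shows that row 1 has about T/m in the special
columns, and T ≈ smn; the rest of the margin BCn lies in the normal columns. -/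
theorem rare_top_right (hB : 0 < B) (hC : 0 < C) (hδ : 0 < δ) (hδ1 : δ < 1) {s : ℝ}
    (hup : ∀ η : ℝ, 0 < η → Rare B C δ fun n => {A | (s + η) * bezel n δ * n
      ≤ (blockSum A (specialIndices n δ) (specialIndices n δ) : ℝ)})
    (hlo : ∀ η : ℝ, 0 < η → Rare B C δ fun n =>
      {A | (blockSum A (specialIndices n δ) (specialIndices n δ) : ℝ)
        ≤ (s - η) * bezel n δ * n}) {ε : ℝ} (hε : 0 < ε) :
    Rare B C δ fun n => {A | ε ≤ |1 / (n : ℝ) *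
      ∑ k ∈ Finset.Icc 1 n, (entry A 1 (k + bezel n δ) : ℝ) - (B * C - s)|} := by
  -- Three errors of size ε/4 each: the rounded margin, the row deviation and the block sum.
  have he : 0 < ε / 4 := by positivity
  refine (((rare_large_special_entry hB hC hδ hδ1).union
    (rare_row_deviation hB hC hδ hδ1 he)).union ((hup _ he).union (hlo _ he))).mono ?_
  have hRlim := tendsto_floor_mul_div (a := B * C) (by positivity)
  rw [Metric.tendsto_nhds] at hRlim
  filter_upwards [eventually_ge_atTop 1, hRlim _ he] with n hn hR A hA hdev
  by_contra hnot
  simp only [Set.mem_union, not_or] at hnot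
  obtain ⟨⟨h1, h2⟩, h3, h4⟩ := hnot
  have h1' : ∀ i ∈ specialIndices n δ, ∀ j ∈ specialIndices n δ,
      (A i j : ℝ) < (n : ℝ) ^ (1 - δ / 2) := fun i hi j hj =>
    not_le.mp fun h => h1 ⟨i, hi, j, hj, h⟩
  have hm := one_le_bezel hn hδ.le
  have hn0 : (0 : ℝ) < n := by exact_mod_cast hn
  have hm0 : (0 : ℝ) < bezel n δ := by exact_mod_cast hm
  let i₀ : Fin (bezel n δ + n) := ⟨0, by omega⟩
  set a := ∑ j ∈ specialIndices n δ, (A i₀ j : ℝ) with ha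
  have h2' : ∀ i ∈ specialIndices n δ,
      |a - ∑ j ∈ specialIndices n δ, (A i j : ℝ)| ≤ ε / 4 * n := fun i hi =>
    le_of_not_ge fun h => h2 ⟨i₀, rfl, ⟨i, hi, h⟩, h1'⟩
  set T : ℝ := (blockSum A (specialIndices n δ) (specialIndices n δ) : ℝ) with hT
  have h3' : T < (s + ε / 4) * bezel n δ * n := not_le.mp h3
  have h4' : (s - ε / 4) * bezel n δ * n < T := not_le.mp h4
  have h5 : |bezel n δ * a - T| ≤ bezel n δ * (ε / 4 * n) := by
    have h6 : bezel n δ * a - T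
        = ∑ i ∈ specialIndices n δ, (a - ∑ j ∈ specialIndices n δ, (A i j : ℝ)) := by
      rw [Finset.sum_sub_distrib, Finset.sum_const, card_specialIndices, hT, blockSum]
      push_cast
      simp
    rw [h6]
    refine (Finset.abs_sum_le_sum_abs _ _).trans ((Finset.sum_le_card_nsmul _ _ _ h2').trans ?_)
    rw [card_specialIndices, nsmul_eq_mul]
  have h7 := abs_le.mp h5
  have h8 : a - s * n ≤ ε / 2 * n := by
    refine le_of_mul_le_mul_left ?_ hm0
    linarith [h7.2]
  have h9 : -(ε / 2 * n) ≤ a - s * n := by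
    refine le_of_mul_le_mul_left ?_ hm0
    linarith [h7.1]
  have h10 := sum_entry_eq_sub hA i₀
  rw [blockMargin_special i₀ (mem_specialIndices.mpr hm), ← ha] at h10
  have hentry : ∑ k ∈ Finset.Icc 1 n, (entry A 1 (k + bezel n δ) : ℝ) = ⌊B * C * n⌋₊ - a := h10
  rw [Real.dist_eq] at hR
  change ε ≤ _ at hdev
  rw [hentry] at hdev
  have h11 : 1 / (n : ℝ) * (⌊B * C * n⌋₊ - a) - (B * C - s)
      = ((⌊B * C * n⌋₊ : ℝ) / n - B * C) - (a - s * n) / n := by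
    field_simp
    ring
  have h12 : |(a - s * n) / n| ≤ ε / 2 := by
    rw [abs_div, abs_of_pos hn0, div_le_iff₀ hn0]
    exact abs_le.mpr ⟨h9, h8⟩
  rw [h11] at hdev
  have h13 := abs_sub ((⌊B * C * n⌋₊ : ℝ) / n - B * C) ((a - s * n) / n)
  linarith

theorem rare_bottom_right (hB : 0 < B) (hC : 0 < C) (hδ : 0 ≤ δ) (hδ1 : δ < 1) {ε : ℝ}
    (hε : 0 < ε) :
    Rare B C δ fun n => {A | ε ≤ |1 / (n : ℝ) *
      ∑ k ∈ Finset.Icc 1 n, (entry A (n + 1) (k + bezel n δ) : ℝ) - C|} := by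
  have he : 0 < ε / 4 := by positivity
  refine (rare_large_mixed_entry hB hC hδ hδ1 he).mono ?_
  have hqlim := tendsto_floor_mul_div hC.le
  rw [Metric.tendsto_nhds] at hqlim
  filter_upwards [eventually_ge_atTop 1, hqlim _ he] with n hn hq A hA hdev
  by_contra hnot
  have hm := one_le_bezel hn hδ
  have hmn := bezel_le hn hδ1.le
  have hn0 : (0 : ℝ) < n := by exact_mod_cast hn
  have hm0 : (0 : ℝ) < bezel n δ := by exact_mod_cast hm
  -- The zero-based index n is row n + 1, which is normal because m ≤ n.
  let i₀ : Fin (bezel n δ + n) := ⟨n, by omega⟩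
  have hi₀ : i₀ ∉ specialIndices n δ := by
    rw [mem_specialIndices]
    simp only [i₀]
    omega
  set a := ∑ j ∈ specialIndices n δ, (A i₀ j : ℝ) with ha
  have ha0 : 0 ≤ a := Finset.sum_nonneg fun _ _ => Nat.cast_nonneg _
  have ha1 : a ≤ ε / 4 * n := by
    calc a ≤ (specialIndices n δ).card • (ε / 4 * n / bezel n δ) :=
          Finset.sum_le_card_nsmul _ _ _ fun j hj =>
            le_of_not_ge fun h => hnot ⟨i₀, Finset.mem_compl.mpr hi₀, j, hj, h⟩
      _ = ε / 4 * n := by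
        rw [card_specialIndices, nsmul_eq_mul]
        field_simp
  have h10 := sum_entry_eq_sub hA i₀
  rw [blockMargin_normal i₀ hi₀, ← ha] at h10
  have hentry : ∑ k ∈ Finset.Icc 1 n, (entry A (n + 1) (k + bezel n δ) : ℝ) = ⌊C * n⌋₊ - a := h10
  rw [Real.dist_eq] at hq
  change ε ≤ _ at hdev
  rw [hentry] at hdev
  have h11 : 1 / (n : ℝ) * (⌊C * n⌋₊ - a) - C = ((⌊C * n⌋₊ : ℝ) / n - C) - a / n := by
    field_simp
    ring
  have h12 : |a / n| ≤ ε / 4 := by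
    rw [abs_of_nonneg (by positivity), div_le_iff₀ hn0]
    exact ha1
  rw [h11] at hdev
  have h13 := abs_sub ((⌊C * n⌋₊ : ℝ) / n - C) (a / n)
  linarith

theorem rare_top_right_of_lt (hB : 0 < B) (hC : 0 < C) (hδ : 0 < δ) (hδ1 : δ < 1)
    (hBc : B < criticalValue C) {ε : ℝ} (hε : 0 < ε) :
    Rare B C δ fun n => {A | ε ≤ |1 / (n : ℝ) *
      ∑ k ∈ Finset.Icc 1 n, (entry A 1 (k + bezel n δ) : ℝ) - B * C|} := by
  have hBC : 0 < B * C := by positivity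
  have h := rare_top_right (s := 0) hB hC hδ hδ1 (fun η hη => ?_) (fun η hη => ?_) hε
  · simpa using h
  · have h1 := rare_bulk_ge hB hC hδ hδ1 (β := B * C) (σ := η / 2) (η := η / 2) hBC (by positivity)
      (by positivity) (by linarith) (sq_ratio_lt_one hC hBC (by gcongr))
    simpa using h1
  -- With s = 0 the event is empty: a block sum is not negative.
  · apply Rare.of_card_le 0
    filter_upwards [eventually_ge_atTop 1] with n hn
    refine ⟨∅, fun A hA h1 => ?_, by simp⟩
    exfalso
    have hm : (1 : ℝ) ≤ bezel n δ := by exact_mod_cast one_le_bezel hn hδ.le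
    have hn0 : (1 : ℝ) ≤ n := by exact_mod_cast hn
    have h2 : (0 : ℝ) ≤ (blockSum A (specialIndices n δ) (specialIndices n δ) : ℝ) :=
      Nat.cast_nonneg _
    have h3 : 0 < η * bezel n δ * n := by positivity
    linarith

theorem rare_top_right_of_gt (hB : 0 < B) (hC : 0 < C) (hδ : 0 < δ) (hδ1 : δ < 1)
    (hBc : criticalValue C < B) {ε : ℝ} (hε : 0 < ε) :
    Rare B C δ fun n => {A | ε ≤ |1 / (n : ℝ) *
      ∑ k ∈ Finset.Icc 1 n, (entry A 1 (k + bezel n δ) : ℝ) - criticalValue C * C|} := by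
  have hc0 : 0 < criticalValue C := by
    rw [criticalValue]
    positivity
  set b := criticalValue C * C with hb
  have hb0 : 0 < b := by positivity
  have hbBC : b < B * C := by
    rw [hb]
    gcongr
  have h := rare_top_right (s := B * C - b) hB hC hδ hδ1 (fun η hη => ?_) (fun η hη => ?_) hε
  · simpa using h
  -- The natural choice β = b - η/2 may fail to be positive; the maximum with b/2 repairs this and
  -- stays below b.
  · have hmax : max (b - η / 2) (b / 2) < b := max_lt (by linarith) (by linarith)
    have hmax0 : 0 < max (b - η / 2) (b / 2) := lt_max_of_lt_right (by positivity)
    have h1 := rare_bulk_ge hB hC hδ hδ1 (β := max (b - η / 2) (b / 2)) (σ := B * C - b + η / 2)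
      (η := η / 2) hmax0 (by linarith) (by positivity)
      (by linarith [le_max_left (b - η / 2) (b / 2)]) (sq_ratio_lt_one hC hmax0 hmax)
    rwa [show B * C - b + η / 2 + η / 2 = B * C - b + η by ring] at h1
  -- The cap keeps BC - b - x positive, as `rare_bulk_le` requires; a smaller tolerance gives a
  -- larger event.
  · set x := min η ((B * C - b) / 2) with hx
    have hx0 : 0 < x := lt_min hη (by linarith)
    have hx1 : x ≤ (B * C - b) / 2 := min_le_right _ _
    have hx2 : x ≤ η := min_le_left _ _
    have h1 := rare_bulk_le hB hC hδ hδ1 (β := b + x / 4) (σ := B * C - b - x / 2) (η := x / 2)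
      (by positivity) (by positivity) (by linarith) (by linarith)
      (one_lt_sq_ratio hC (by linarith))
    refine h1.mono (Eventually.of_forall fun n A _ hA => ?_)
    change _ ≤ (_ : ℝ) at hA
    exact hA.trans (mul_le_mul_of_nonneg_right
      (mul_le_mul_of_nonneg_right (by linarith) (Nat.cast_nonneg _)) (Nat.cast_nonneg _))

end Main

end ContingencyTable

theorem theorem3 (B C δ : ℝ) (hB : 0 < B) (hC : 0 < C)
    {Ω : Type*} [MeasurableSpace Ω] (P : Measure Ω) [IsProbabilityMeasure P]
    (X : (n : ℕ) → Ω → Table (bezel n δ + n) (bezel n δ + n))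
    (hX : ∀ n : ℕ, 1 ≤ n → HasLaw (X n) (uniformOn (blockTables n δ B C)) P) :
    (1 / 2 < δ → δ < 1 →
      (B < criticalValue C →
        ∀ᵐ ω ∂P, Tendsto
          (fun n : ℕ => (1 / (n : ℝ)) *
            ∑ k ∈ Finset.Icc 1 n, (entry (X n ω) 1 (k + bezel n δ) : ℝ))
          atTop (𝓝 (B * C))) ∧
      (criticalValue C < B →
        ∀ᵐ ω ∂P, Tendsto
          (fun n : ℕ => (1 / (n : ℝ)) *
            ∑ k ∈ Finset.Icc 1 n, (entry (X n ω) 1 (k + bezel n δ) : ℝ))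
          atTop (𝓝 (criticalValue C * C)))) ∧
    (0 ≤ δ → δ < 1 →
      ∀ᵐ ω ∂P, Tendsto
        (fun n : ℕ => (1 / (n : ℝ)) *
          ∑ k ∈ Finset.Icc 1 n, (entry (X n ω) (n + 1) (k + bezel n δ) : ℝ))
        atTop (𝓝 C)) := by
  refine ⟨fun hδ hδ1 => ⟨fun hBc => ?_, fun hBc => ?_⟩, fun hδ hδ1 => ?_⟩
  · exact ContingencyTable.ae_tendsto_of_rare hX
      (fun n A => 1 / (n : ℝ) * ∑ k ∈ Finset.Icc 1 n, (entry A 1 (k + bezel n δ) : ℝ)) _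
      fun ε hε => ContingencyTable.rare_top_right_of_lt hB hC (by linarith) hδ1 hBc hε
  · exact ContingencyTable.ae_tendsto_of_rare hX
      (fun n A => 1 / (n : ℝ) * ∑ k ∈ Finset.Icc 1 n, (entry A 1 (k + bezel n δ) : ℝ)) _
      fun ε hε => ContingencyTable.rare_top_right_of_gt hB hC (by linarith) hδ1 hBc hε
  · exact ContingencyTable.ae_tendsto_of_rare hX
      (fun n A => 1 / (n : ℝ) * ∑ k ∈ Finset.Icc 1 n, (entry A (n + 1) (k + bezel n δ) : ℝ)) _
      fun ε hε => ContingencyTable.rare_bottom_right hB hC hδ hδ1 hε
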